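/- Let $T,\alpha,\beta>0$ and let $f\colon L^2(0,T)\to\mathbb R$ be Fréchet differentiable (not necessarily convex), with $L^2$-gradient $\nabla f$. For $u\in \mathrm{BV}(0,T)$ (the $L^1$ functions whose distributional derivative is a finite signed Radon measure on $(0,T)$; $\mathrm{BV}(0,T)\subset L^2(0,T)$) let $$\operatorname{TGV}_{\alpha,\beta}(u)=\sup\Big\{\int_0^T u\,v''\,\mathrm dx \;\Big|\; v\in C_c^\infty(0,T),\ \|v\|_\infty\le\alpha,\ \|v'\|_\infty\le\beta\Big\}.$$ Let $\bar u\in\mathrm{BV}(0,T)$ be a minimizer of $f+\operatorname{TGV}_{\alpha,\beta}$ over $\mathrm{BV}(0,T)$, and suppose that the dual variables $$\bar p(x)=\int_0^x \nabla f(\bar u)(t)\,\mathrm dt,\qquad \bar P(x)=-\int_0^x\bar p(t)\,\mathrm dt$$ are real analytic on $(0,T)$. Then $\bar u$ is piecewise affine, in the following sense: there are finite sets of points $\{x^S_j\}_{j=1}^{N_S},\{x^K_j\}_{j=1}^{N_K}\subset(0,T)$ (possibly empty), signs $\sigma^S_j,\sigma^K_j\in\{-1,1\}$, weights $\lambda^S_j,\lambda^K_j\ge0$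 and $a,b\in\mathbb R$ such that, for almost every $x\in(0,T)$, $$\bar u(x)=\frac1\alpha\sum_{j=1}^{N_S}\sigma^S_j\lambda^S_j\,S_{x^S_j}(x)+\frac1\beta\sum_{j=1}^{N_K}\sigma^K_j\lambda^K_j\,K_{x^K_j}(x)+ax+b,$$ where $S_{y}=1_{(y,T)}$, and $K_{y}(x)=1_{(0,y)}(x)\,(y-x)$ if $y<T/2$, $K_{y}(x)=1_{(y,T)}(x)\,(x-y)$ if $y\ge T/2$. -/

import Mathlib

open MeasureTheory Set
open scoped ContDiff

namespace TGVReg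

noncomputable section

/-- The space `C_c^∞(0,T)` of smooth functions compactly supported in the open interval. -/
def IsTest (T : ℝ) (φ : ℝ → ℝ) : Prop :=
  ContDiff ℝ ∞ φ ∧ HasCompactSupport φ ∧ tsupport φ ⊆ Ioo 0 T

/-- `u` represents an element of `BV(0,T)`: it is integrable on `(0,T)` and its distributional
derivative on `(0,T)` is a finite signed Radon measure, written as the difference `μ - ν` of two
finite positive Borel measures. -/
def IsBV (T : ℝ) (u : ℝ → ℝ) : Prop :=
  IntegrableOn u (Ioo 0 T) ∧
    ∃ μ ν : Measure ℝ, IsFiniteMeasure μ ∧ IsFiniteMeasure ν ∧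
      ∀ φ : ℝ → ℝ, IsTest T φ →
        ∫ x in Ioo 0 T, u x * deriv φ x = -(∫ x, φ x ∂μ - ∫ x, φ x ∂ν)

/-- The Hilbert space `L²(0,T)`. -/
abbrev L2 (T : ℝ) : Type := Lp ℝ 2 (volume.restrict (Ioo (0 : ℝ) T))

/-- `BV(0,T)` as a subset of `L²(0,T)`. In dimension one functions of bounded variation on a
bounded interval are (essentially) bounded, so this is all of `BV(0,T)`. -/
def BV (T : ℝ) : Set (L2 T) := {u | IsBV T u}

/-- The set of values `∫₀ᵀ u v''`, with `v` a test function such that `|v| ≤ α`, `|v'| ≤ β`. -/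
def tgvSet (T α β : ℝ) (u : ℝ → ℝ) : Set ℝ :=
  {r | ∃ v : ℝ → ℝ, IsTest T v ∧ (∀ x ∈ Ioo 0 T, |v x| ≤ α) ∧
    (∀ x ∈ Ioo 0 T, |deriv v x| ≤ β) ∧
    r = ∫ x in Ioo 0 T, u x * iteratedDeriv 2 v x}

/-- The total generalized variation of order two, for `u` in `BV(0,T)`, where the supremum is
finite (see `tgvSet_nonempty` and `bddAbove_tgvSet`). -/
def TGV (T α β : ℝ) (u : ℝ → ℝ) : ℝ := sSup (tgvSet T α β u)

theorem tgvSet_nonempty {T α β : ℝ} (hα : 0 < α) (hβ : 0 < β) (u : ℝ → ℝ) :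
    (tgvSet T α β u).Nonempty := by
  refine ⟨_, 0, ⟨contDiff_const, HasCompactSupport.zero, ?_⟩, ?_, ?_, rfl⟩
  · simp [tsupport]
  · intro x _; simpa using hα.le
  · intro x _
    have : deriv (0 : ℝ → ℝ) x = 0 := by simp
    rw [this]; simpa using hβ.le

theorem bddAbove_tgvSet {T α β : ℝ} (hβ : 0 < β) {u : ℝ → ℝ} (hu : IsBV T u) :
    BddAbove (tgvSet T α β u) := by
  obtain ⟨-, μ, ν, hμ, hν, h⟩ := hu
  refine ⟨β * μ.real univ + β * ν.real univ, ?_⟩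
  rintro r ⟨v, ⟨hv1, hv2, hv3⟩, -, hb, rfl⟩
  have hsub : tsupport (deriv v) ⊆ tsupport v := tsupport_deriv_subset
  have htest : IsTest T (deriv v) :=
    ⟨((contDiff_infty_iff_deriv (𝕜 := ℝ)).1 hv1).2, hv2.deriv, hsub.trans hv3⟩
  have hb' : ∀ x, ‖deriv v x‖ ≤ β := by
    intro x
    by_cases hx : x ∈ Ioo 0 T
    · exact hb x hx
    · have : deriv v x = 0 :=
        image_eq_zero_of_notMem_tsupport fun hx' => hx (htest.2.2 hx')
      simpa [this] using hβ.le
  have e : ∀ x, iteratedDeriv 2 v x = deriv (deriv v) x := by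
    intro x; simp [iteratedDeriv_succ]
  simp only [e]
  rw [h _ htest]
  have h1 := norm_integral_le_of_norm_le_const (μ := μ) (Filter.Eventually.of_forall hb')
  have h2 := norm_integral_le_of_norm_le_const (μ := ν) (Filter.Eventually.of_forall hb')
  rw [Real.norm_eq_abs, abs_le] at h1 h2
  linarith [h1.1, h2.2]

/-- The jump `S_{x₀} = 1_{(x₀,T)}`. -/
def jump (T x₀ : ℝ) : ℝ → ℝ := (Ioo x₀ T).indicator fun _ => 1

/-- The kink `K_{x₁}`. -/
def kink (T x₁ : ℝ) : ℝ → ℝ :=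
  if x₁ < T / 2 then (Ioo 0 x₁).indicator fun x => x₁ - x
  else (Ioo x₁ T).indicator fun x => x - x₁

/-- Almost everywhere on `(0,T)`, `u` is a finite conic combination of functions `± S_x / α` and
`± K_x / β`, with jump points and kink points in `(0,T)`, plus an affine function. -/
def IsSparse (T α β : ℝ) (u : ℝ → ℝ) : Prop :=
  ∃ (XS XK : Finset ℝ) (σS σK lS lK : ℝ → ℝ) (a b : ℝ),
    (∀ x ∈ XS, x ∈ Ioo 0 T ∧ (σS x = -1 ∨ σS x = 1) ∧ 0 ≤ lS x) ∧
    (∀ x ∈ XK, x ∈ Ioo 0 T ∧ (σK x = -1 ∨ σK x = 1) ∧ 0 ≤ lK x) ∧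
    ∀ᵐ t ∂(volume.restrict (Ioo 0 T)),
      u t = 1 / α * ∑ x ∈ XS, σS x * lS x * jump T x t
        + 1 / β * ∑ x ∈ XK, σK x * lK x * kink T x t + a * t + b

/-- The dual variable `p̄(x) = ∫₀ˣ ∇f(ū)`, for `x` in `(0,T)`. -/
def dualp {T : ℝ} (f : L2 T → ℝ) (u : L2 T) (x : ℝ) : ℝ :=
  ∫ t in (0 : ℝ)..x, (gradient f u : L2 T) t

/-- The dual variable `P̄(x) = -∫₀ˣ p̄`, for `x` in `(0,T)`. -/
def dualP {T : ℝ} (f : L2 T → ℝ) (u : L2 T) (x : ℝ) : ℝ :=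
  -∫ t in (0 : ℝ)..x, dualp f u t

end

end TGVReg

namespace TGVReg

open Filter Topology

/-! The argument shows that $\bar P$ is, up to truncation, an optimal competitor in the supremum
defining $\operatorname{TGV}(\bar u)$, and that $\bar u''$ vanishes wherever the constraints on it
are inactive. Write $g=\nabla f(\bar u)$, so $\bar P'=-\bar p$ and $\bar P''=-g$ a.e. The directions
$\pm w$, with $w$ a jump or a ramp at $y$, give first order conditions in which $w''$ acts on a
competitor $v$ as $-v'(y)$ or $v(y)$. At $y=0$ these pairings vanish, whence $\bar p(T)=\bar
P(T)=0$; at interior $y$ they give $|\bar p|\le\beta$ and $|\bar P|\le\alpha$. The direction $-\bar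
u$ gives $\langle g,\bar u\rangle+\operatorname{TGV}(\bar u)\le0$ (`inner_gradient_add_TGV_le`),
that is, $\int\bar u\bar P''\ge\operatorname{TGV}(\bar u)$. Although $\bar P$ lacks compact support,
its decay at the endpoints allows cutting it off with arbitrarily small loss (`exists_test_approx`).
Perturbing the truncation by $\pm\varepsilon\varphi$, with $\varphi$ supported where $|\bar
P|<\alpha$ and $|\bar p|<\beta$, yields $\int\bar u\varphi''=0$
(`integral_mul_deriv_deriv_eq_zero`), so $\bar u$ is affine on each interval of that open set
(`ae_eq_affine`). By analyticity and the zero boundary values, the contact set is finite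
(`finite_level_set`), and gluing the affine pieces produces jumps and kinks (`exists_ramp_repr`). -/

/-- Smooth functions with compact support in `U`. -/
def IsTestOn (U : Set ℝ) (φ : ℝ → ℝ) : Prop :=
  ContDiff ℝ ∞ φ ∧ HasCompactSupport φ ∧ tsupport φ ⊆ U

/-! ### Calculus of test functions. -/

namespace IsTestOn

variable {U V : Set ℝ} {φ ψ : ℝ → ℝ}

protected theorem mono (h : IsTestOn U φ) (hUV : U ⊆ V) : IsTestOn V φ :=
  ⟨h.1, h.2.1, h.2.2.trans hUV⟩

protected theorem continuous (h : IsTestOn U φ) : Continuous φ := h.1.continuous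

protected theorem differentiable (h : IsTestOn U φ) : Differentiable ℝ φ :=
  h.1.differentiable (by simp)

theorem eq_zero (h : IsTestOn U φ) {x : ℝ} (hx : x ∉ U) : φ x = 0 :=
  image_eq_zero_of_notMem_tsupport fun hx' => hx (h.2.2 hx')

protected theorem deriv (h : IsTestOn U φ) : IsTestOn U (deriv φ) :=
  ⟨((contDiff_infty_iff_deriv (𝕜 := ℝ)).1 h.1).2, h.2.1.deriv,
    tsupport_deriv_subset.trans h.2.2⟩

protected theorem add (h : IsTestOn U φ) (h' : IsTestOn U ψ) : IsTestOn U (fun x => φ x + ψ x) :=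
  ⟨h.1.add h'.1, h.2.1.add h'.2.1, (tsupport_add φ ψ).trans (union_subset h.2.2 h'.2.2)⟩

protected theorem const_mul (h : IsTestOn U φ) (c : ℝ) : IsTestOn U (fun x => c * φ x) :=
  ⟨contDiff_const.mul h.1, h.2.1.mul_left, (tsupport_mul_subset_right).trans h.2.2⟩

theorem exists_bound (h : IsTestOn U φ) : ∃ C, 0 ≤ C ∧ ∀ x, |φ x| ≤ C := by
  obtain ⟨C, hC⟩ := h.2.1.exists_bound_of_continuous h.continuous
  exact ⟨C, (norm_nonneg _).trans (hC 0), hC⟩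

theorem integrable_mul (h : IsTestOn U φ) {u : ℝ → ℝ} {μ : Measure ℝ} (hu : Integrable u μ) :
    Integrable (fun x => u x * φ x) μ := by
  obtain ⟨C, -, hC⟩ := h.exists_bound
  exact hu.mul_bdd h.continuous.aestronglyMeasurable (Eventually.of_forall hC)

theorem integrable (h : IsTestOn U φ) {μ : Measure ℝ} [IsFiniteMeasureOnCompacts μ] :
    Integrable φ μ :=
  h.continuous.integrable_of_hasCompactSupport h.2.1

theorem setIntegral_eq (h : IsTestOn U φ) (u : ℝ → ℝ) :
    ∫ x in U, u x * φ x = ∫ x, u x * φ x :=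
  setIntegral_eq_integral_of_forall_compl_eq_zero fun x hx => by simp [h.eq_zero hx]

end IsTestOn

theorem exists_Icc_of_isCompact_subset_Ioo {K : Set ℝ} {a b : ℝ} (hab : a < b) (hK : IsCompact K)
    (h : K ⊆ Ioo a b) : ∃ c d, a < c ∧ c ≤ d ∧ d < b ∧ K ⊆ Icc c d := by
  rcases K.eq_empty_or_nonempty with rfl | hne
  · exact ⟨(a + b) / 2, (a + b) / 2, by linarith, le_rfl, by linarith, by simp⟩
  · obtain ⟨c, hc⟩ := hK.exists_isLeast hne
    obtain ⟨d, hd⟩ := hK.exists_isGreatest hne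
    exact ⟨c, d, (h hc.1).1, hc.2 hd.1, (h hd.1).2, fun x hx => ⟨hc.2 hx, hd.2 hx⟩⟩

theorem isTestOn_Ioo_of_eq_zero {a b c d : ℝ} {φ : ℝ → ℝ} (h : ContDiff ℝ ∞ φ) (hac : a < c)
    (hdb : d < b) (h0 : ∀ x, x ∉ Icc c d → φ x = 0) : IsTestOn (Ioo a b) φ := by
  have hs : tsupport φ ⊆ Icc c d :=
    closure_minimal (fun x hx => by_contra fun hx' => hx (h0 x hx')) isClosed_Icc
  exact ⟨h, isCompact_Icc.of_isClosed_subset (isClosed_tsupport _) hs,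
    hs.trans (Icc_subset_Ioo hac hdb)⟩

theorem IsTestOn.exists_antideriv {a b : ℝ} (hab : a < b) {ψ : ℝ → ℝ}
    (h : IsTestOn (Ioo a b) ψ) (h0 : ∫ x, ψ x = 0) :
    ∃ φ, IsTestOn (Ioo a b) φ ∧ deriv φ = ψ := by
  obtain ⟨c, d, hac, hcd, hdb, hK⟩ := exists_Icc_of_isCompact_subset_Ioo hab h.2.1 h.2.2
  have hz : ∀ x, x ∉ Icc c d → ψ x = 0 := fun x hx =>
    image_eq_zero_of_notMem_tsupport fun hx' => hx (hK hx')
  have hd : ∀ x, HasDerivAt (fun x => ∫ t in a..x, ψ t) (ψ x) x := fun x =>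
    h.continuous.integral_hasStrictDerivAt a x |>.hasDerivAt
  have hd' : deriv (fun x => ∫ t in a..x, ψ t) = ψ := funext fun x => (hd x).deriv
  refine ⟨fun x => ∫ t in a..x, ψ t, isTestOn_Ioo_of_eq_zero ?_ hac hdb ?_, hd'⟩
  · rw [contDiff_infty_iff_deriv, hd']
    exact ⟨fun x => (hd x).differentiableAt, h.1⟩
  · intro x hx
    rcases lt_or_ge x c with hxc | hxc
    · rw [intervalIntegral.integral_congr (g := fun _ => 0), intervalIntegral.integral_zero]
      intro t ht
      refine hz t fun ht' => ?_
      have := ht.2.trans (max_le hac.le hxc.le)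
      have h3 : max a x < c := max_lt hac hxc
      exact absurd (ht'.1.trans ht.2) (not_le.2 h3)
    · have hxd : d < x := by
        by_contra hh
        exact hx ⟨hxc, not_lt.1 hh⟩
      rw [intervalIntegral.integral_eq_integral_of_support_subset, h0]
      intro t ht
      have : t ∈ Icc c d := by_contra fun hh => ht (hz t hh)
      exact ⟨hac.trans_le this.1, this.2.trans hxd.le⟩

/-! ### Distributions with vanishing first or second derivative. -/

/-- A linear functional on test functions which vanishes on derivatives is a multiple of the
integral. -/
theorem exists_eq_mul_integral {a b : ℝ} (hab : a < b) (Λ : (ℝ → ℝ) → ℝ)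
    (hΛ : ∀ φ ψ, IsTestOn (Ioo a b) φ → IsTestOn (Ioo a b) ψ → ∀ c : ℝ,
      Λ (fun x => φ x + c * ψ x) = Λ φ + c * Λ ψ)
    (h0 : ∀ φ, IsTestOn (Ioo a b) φ → Λ (deriv φ) = 0) :
    ∃ c, ∀ φ, IsTestOn (Ioo a b) φ → Λ φ = c * ∫ x, φ x := by
  let B : ContDiffBump ((a + b) / 2) :=
    ⟨(b - a) / 8, (b - a) / 4, by linarith, by linarith⟩
  have hB : IsTestOn (Ioo a b) (B.normed volume) := by
    refine ⟨B.contDiff_normed, B.hasCompactSupport_normed, ?_⟩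
    rw [B.tsupport_normed_eq, Real.closedBall_eq_Icc]
    have : B.rOut = (b - a) / 4 := rfl
    rw [this]
    exact Icc_subset_Ioo (by linarith) (by linarith)
  refine ⟨Λ (B.normed volume), fun φ hφ => ?_⟩
  -- Subtracting the unit-mass bump times the mass of `φ` leaves a test function of mean zero, hence
  -- the derivative of a test function.
  have ht := hφ.add (hB.const_mul (-∫ x, φ x))
  obtain ⟨ψ, hψ, hψ'⟩ := ht.exists_antideriv hab (by
    rw [integral_add hφ.integrable (hB.const_mul _).integrable, integral_const_mul,
      B.integral_normed]
    ring)
  have h1 := h0 ψ hψ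
  rw [hψ', hΛ _ _ hφ hB] at h1
  linarith

theorem IsTestOn.integral_mul_deriv {U : Set ℝ} {φ : ℝ → ℝ} (h : IsTestOn U φ) {w w' : ℝ → ℝ}
    (hw : ∀ x, HasDerivAt w (w' x) x) (hw' : Continuous w') :
    ∫ x, w x * _root_.deriv φ x = -∫ x, w' x * φ x := by
  have hc : Continuous w := continuous_iff_continuousAt.2 fun x => (hw x).continuousAt
  refine integral_mul_deriv_eq_deriv_mul_of_integrable (fun x _ => hw x)
    (fun x _ => h.differentiable.differentiableAt.hasDerivAt) ?_ ?_ ?_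
  · exact (hc.mul h.deriv.continuous).integrable_of_hasCompactSupport h.deriv.2.1.mul_left
  · exact (hw'.mul h.continuous).integrable_of_hasCompactSupport h.2.1.mul_left
  · exact (hc.mul h.continuous).integrable_of_hasCompactSupport h.2.1.mul_left

/-- An integrable function whose second distributional derivative vanishes is affine. -/
theorem ae_eq_affine {a b : ℝ} (hab : a < b) {u : ℝ → ℝ} (hu : IntegrableOn u (Ioo a b))
    (h : ∀ φ, IsTestOn (Ioo a b) φ → ∫ x in Ioo a b, u x * deriv (deriv φ) x = 0) :
    ∃ A B : ℝ, ∀ᵐ x ∂volume.restrict (Ioo a b), u x = A * x + B := by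
  have hder : ∀ φ ψ : ℝ → ℝ, IsTestOn (Ioo a b) φ → IsTestOn (Ioo a b) ψ → ∀ c : ℝ,
      deriv (fun x => φ x + c * ψ x) = fun x => deriv φ x + c * deriv ψ x := by
    intro φ ψ hφ hψ c
    funext x
    have h1 := hφ.differentiable x
    have h2 := hψ.differentiable x
    rw [deriv_fun_add h1 (h2.const_mul c), deriv_const_mul c h2]
  have hlin : ∀ w : ℝ → ℝ, IntegrableOn w (Ioo a b) → ∀ φ ψ : ℝ → ℝ, IsTestOn (Ioo a b) φ →
      IsTestOn (Ioo a b) ψ → ∀ c : ℝ, ∫ x in Ioo a b, w x * (φ x + c * ψ x) =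
        (∫ x in Ioo a b, w x * φ x) + c * ∫ x in Ioo a b, w x * ψ x := by
    intro w hw φ ψ hφ hψ c
    rw [← integral_const_mul, ← integral_add (hφ.integrable_mul hw)
      ((hψ.integrable_mul hw).const_mul c)]
    exact integral_congr_ae (Eventually.of_forall fun x => by simp only; ring)
  obtain ⟨c, hc⟩ := exists_eq_mul_integral hab (fun ψ => ∫ x in Ioo a b, u x * deriv ψ x)
    (fun φ ψ hφ hψ c => by
      simp only [hder φ ψ hφ hψ c]
      exact hlin u hu _ _ hφ.deriv hψ.deriv c) h
  have hid : IntegrableOn (fun x : ℝ => c * x) (Ioo a b) :=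
    (((continuous_const.mul continuous_id).integrableOn_Icc).mono_set Ioo_subset_Icc_self)
  have hw : IntegrableOn (fun x => u x + c * x) (Ioo a b) := hu.add hid
  -- The first application says that `u` has distributional derivative `-c`, so `u + c * x` has
  -- derivative zero and the same lemma applies to it.
  obtain ⟨B, hB⟩ := exists_eq_mul_integral hab (fun ψ => ∫ x in Ioo a b, (u x + c * x) * ψ x)
    (fun φ ψ hφ hψ c => hlin _ hw _ _ hφ hψ c) (fun φ hφ => by
      have e1 : ∫ x in Ioo a b, (u x + c * x) * deriv φ x =
          (∫ x in Ioo a b, u x * deriv φ x) + ∫ x in Ioo a b, c * x * deriv φ x := by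
        rw [← integral_add (hφ.deriv.integrable_mul hu) (hφ.deriv.integrable_mul hid)]
        exact integral_congr_ae (Eventually.of_forall fun x => by simp only; ring)
      have e2 := hφ.integral_mul_deriv (w := fun x => c * x) (w' := fun _ => c)
        (fun x => by simpa using (hasDerivAt_id x).const_mul c) continuous_const
      rw [e1, hc φ hφ, hφ.deriv.setIntegral_eq, e2, integral_const_mul]
      ring)
  have hv : IntegrableOn (fun x => u x + c * x - B) (Ioo a b) :=
    hw.sub (integrableOn_const (by simp))
  have key := isOpen_Ioo.ae_eq_zero_of_integral_contDiff_smul_eq_zero (U := Ioo a b)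
    (f := fun x => u x + c * x - B) (μ := volume) hv.locallyIntegrableOn (by
      intro g h1 h2 h3
      have hg : IsTestOn (Ioo a b) g := ⟨h1, h2, h3⟩
      have e : ∀ x, g x • (u x + c * x - B) = (u x + c * x - B) * g x := fun x => mul_comm _ _
      simp only [e]
      rw [← hg.setIntegral_eq]
      have e' : ∀ x, (u x + c * x - B) * g x = (u x + c * x) * g x - B * g x := fun x => by ring
      simp only [e']
      rw [integral_sub (hg.integrable_mul hw) (hg.const_mul B).integrable, hB g hg,
        hg.setIntegral_eq (fun _ => B), integral_const_mul, sub_self])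
  refine ⟨-c, B, (ae_restrict_iff' measurableSet_Ioo).2 ?_⟩
  filter_upwards [key] with x hx hxm
  linarith [hx hxm]

/-! ### From affine pieces to sums of jumps and kinks. -/

/-- A function which is a.e. affine on the intervals avoiding a finite set is a combination of
jumps and ramps at the points of this set, plus an affine function. -/
theorem exists_ramp_repr (u : ℝ → ℝ) (E : Finset ℝ) : ∀ c : ℝ, 0 < c → (∀ e ∈ E, e ∈ Ioo 0 c) →
    (∀ a b, 0 ≤ a → a < b → b ≤ c → (∀ e ∈ E, e ∉ Ioo a b) →
      ∃ A B : ℝ, ∀ᵐ t ∂volume.restrict (Ioo a b), u t = A * t + B) →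
    ∃ (s k : ℝ → ℝ) (A B : ℝ), ∀ᵐ t ∂volume.restrict (Ioo 0 c),
      u t = ∑ x ∈ E, s x * (if x < t then 1 else 0) + ∑ x ∈ E, k x * max (t - x) 0
        + A * t + B := by
  induction E using Finset.induction_on_max with
  | empty =>
    intro c hc _ h
    obtain ⟨A, B, hAB⟩ := h 0 c le_rfl hc le_rfl (by simp)
    exact ⟨0, 0, A, B, by simpa using hAB⟩
  | insert m E hm ih =>
    intro c hc hE h
    have hmc : m ∈ Ioo 0 c := hE m (by simp)
    have hmE : m ∉ E := fun h' => lt_irrefl _ (hm m h')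
    obtain ⟨s, k, A, B, hl⟩ := ih m hmc.1
      (fun e he => ⟨(hE e (by simp [he])).1, hm e he⟩) (fun a b ha hab hb hav =>
        h a b ha hab (hb.trans hmc.2.le) fun e he => by
          rcases Finset.mem_insert.1 he with rfl | he
          · exact fun h' => absurd h'.2 (not_lt.2 hb)
          · exact hav e he)
    obtain ⟨A', B', hr⟩ := h m c hmc.1.le hmc.2 le_rfl (fun e he => by
      rcases Finset.mem_insert.1 he with rfl | he
      · exact fun h' => lt_irrefl _ h'.1
      · exact fun h' => absurd h'.1 (not_lt.2 (hm e he).le))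
    -- At the largest breakpoint `m`, `km` is the change of slope and `sm` the jump between the
    -- right piece and the left formula continued past `m`, where every earlier jump and ramp is
    -- already switched on.
    set km := A' - (∑ x ∈ E, k x + A) with hkm
    set sm := B' + km * m - (∑ x ∈ E, s x - ∑ x ∈ E, k x * x + B) with hsm
    refine ⟨Function.update s m sm, Function.update k m km, A, B, ?_⟩
    have hsum : ∀ (v : ℝ → ℝ) (y : ℝ) (F : ℝ → ℝ),
        ∑ x ∈ insert m E, Function.update v m y x * F x = y * F m + ∑ x ∈ E, v x * F x := by
      intro v y F
      rw [Finset.sum_insert hmE, Function.update_self]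
      congr 1
      refine Finset.sum_congr rfl fun x hx => ?_
      rw [Function.update_of_ne (ne_of_mem_of_not_mem hx hmE)]
    rw [ae_restrict_iff' measurableSet_Ioo] at hl hr ⊢
    have hne : ∀ᵐ t : ℝ, t ≠ m := by simp [ae_iff, measure_singleton]
    filter_upwards [hl, hr, hne] with t h1 h2 h3 ht
    rw [hsum s sm (fun x => if x < t then 1 else 0), hsum k km (fun x => max (t - x) 0)]
    rcases lt_or_gt_of_ne h3 with htm | htm
    · rw [if_neg htm.not_gt, max_eq_right (by linarith), h1 ⟨ht.1, htm⟩]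
      ring
    · rw [if_pos htm, max_eq_left (by linarith), h2 ⟨htm, ht.2⟩]
      have e1 : ∑ x ∈ E, s x * (if x < t then 1 else 0) = ∑ x ∈ E, s x :=
        Finset.sum_congr rfl fun x hx => by rw [if_pos ((hm x hx).trans htm), mul_one]
      have e2 : ∑ x ∈ E, k x * max (t - x) 0 = t * ∑ x ∈ E, k x - ∑ x ∈ E, k x * x := by
        rw [Finset.mul_sum, ← Finset.sum_sub_distrib]
        refine Finset.sum_congr rfl fun x hx => ?_
        rw [max_eq_left (by linarith [hm x hx])]
        ring
      rw [e1, e2, hsm, hkm]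
      ring

/-- A kink in the left half opens to the left, and a right-opening ramp differs from it by the
affine function `t - x`, since $s^+ = (-s)^+ + s$. -/
theorem max_sub_eq_kink {T x t : ℝ} (ht : t ∈ Ioo 0 T) :
    max (t - x) 0 = kink T x t + if x < T / 2 then t - x else 0 := by
  unfold kink
  split_ifs with h
  · by_cases htx : t < x
    · rw [indicator_of_mem (show t ∈ Ioo 0 x from ⟨ht.1, htx⟩), max_eq_right (by linarith)]
      ring
    · rw [indicator_of_notMem (fun h' => htx h'.2), max_eq_left (by linarith), zero_add]
  · by_cases htx : x < t
    · rw [indicator_of_mem (show t ∈ Ioo x T from ⟨htx, ht.2⟩), max_eq_left (by linarith),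
        add_zero]
    · rw [indicator_of_notMem (fun h' => htx h'.1), max_eq_right (by linarith), add_zero]

theorem isSparse_of_ae_affine {T α β : ℝ} (hT : 0 < T) (hα : 0 < α) (hβ : 0 < β) {u : ℝ → ℝ}
    (E : Finset ℝ) (hE : ∀ e ∈ E, e ∈ Ioo 0 T)
    (h : ∀ a b, 0 ≤ a → a < b → b ≤ T → (∀ e ∈ E, e ∉ Ioo a b) →
      ∃ A B : ℝ, ∀ᵐ t ∂volume.restrict (Ioo a b), u t = A * t + B) :
    IsSparse T α β u := by
  obtain ⟨s, k, A, B, hs⟩ := exists_ramp_repr u E T hT hE h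
  have hsgn : ∀ y : ℝ, (if 0 ≤ y then (1 : ℝ) else -1) * |y| = y := by
    intro y
    split_ifs with hy
    · rw [abs_of_nonneg hy, one_mul]
    · rw [abs_of_neg (not_le.1 hy)]; ring
  have hsgn' : ∀ y : ℝ, (if 0 ≤ y then (1 : ℝ) else -1) = -1 ∨
      (if 0 ≤ y then (1 : ℝ) else -1) = 1 := by
    intro y; split_ifs <;> simp
  -- The factors `α` and `β` in the weights cancel the normalisations; the sums added to `A` and `B`
  -- collect the affine corrections of the left-half kinks.
  refine ⟨E, E, fun x => if 0 ≤ s x then 1 else -1, fun x => if 0 ≤ k x then 1 else -1,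
    fun x => α * |s x|, fun x => β * |k x|,
    A + ∑ x ∈ E, (if x < T / 2 then k x else 0), B + ∑ x ∈ E, (if x < T / 2 then -(k x * x) else 0),
    fun x hx => ⟨hE x hx, hsgn' _, by positivity⟩,
    fun x hx => ⟨hE x hx, hsgn' _, by positivity⟩, ?_⟩
  rw [ae_restrict_iff' measurableSet_Ioo] at hs ⊢
  filter_upwards [hs] with t h1 ht
  have e1 : 1 / α * ∑ x ∈ E, (if 0 ≤ s x then (1 : ℝ) else -1) * (α * |s x|) * jump T x t =
      ∑ x ∈ E, s x * (if x < t then 1 else 0) := by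
    rw [Finset.mul_sum]
    refine Finset.sum_congr rfl fun x _ => ?_
    have e : jump T x t = if x < t then 1 else 0 := by
      simp [jump, indicator_apply, ht.2]
    rw [e, mul_left_comm _ α, hsgn]
    field_simp
  have e2 : 1 / β * ∑ x ∈ E, (if 0 ≤ k x then (1 : ℝ) else -1) * (β * |k x|) * kink T x t =
      ∑ x ∈ E, k x * kink T x t := by
    rw [Finset.mul_sum]
    refine Finset.sum_congr rfl fun x _ => ?_
    rw [mul_left_comm _ β, hsgn]
    field_simp
  have e3 : ∑ x ∈ E, k x * max (t - x) 0 = ∑ x ∈ E, k x * kink T x t +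
      ((∑ x ∈ E, if x < T / 2 then k x else 0) * t +
        ∑ x ∈ E, if x < T / 2 then -(k x * x) else 0) := by
    rw [Finset.sum_mul, ← Finset.sum_add_distrib, ← Finset.sum_add_distrib]
    refine Finset.sum_congr rfl fun x _ => ?_
    rw [max_sub_eq_kink ht]
    split_ifs <;> ring
  rw [e1, e2, h1 ht, e3]
  ring

/-! ### Finiteness of the contact set. -/

/-- Nonzero level sets of an analytic function vanishing at the boundary are finite. -/
theorem finite_level_set {T c : ℝ} (hT : 0 < T) (hc : c ≠ 0) {h : ℝ → ℝ}
    (ha : AnalyticOnNhd ℝ h (Ioo 0 T)) (hcont : ContinuousOn h (Icc 0 T)) (h0 : h 0 = 0)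
    (h1 : h T = 0) : {x ∈ Ioo 0 T | h x = c}.Finite := by
  by_contra hinf
  have hcl : IsClosed (Icc 0 T ∩ h ⁻¹' {c}) :=
    hcont.preimage_isClosed_of_isClosed isClosed_Icc isClosed_singleton
  obtain ⟨z, hz, hacc⟩ := Set.Infinite.exists_accPt_of_subset_isCompact hinf
    (isCompact_Icc.of_isClosed_subset hcl inter_subset_left)
    (fun x hx => ⟨Ioo_subset_Icc_self hx.1, hx.2⟩)
  have hzc : h z = c := hz.2
  -- Analyticity is only available inside the interval; the accumulation point cannot be an endpoint
  -- because `h` vanishes there while `h z = c ≠ 0`.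
  have hz' : z ∈ Ioo 0 T := by
    refine ⟨lt_of_le_of_ne hz.1.1 fun e => hc ?_, lt_of_le_of_ne hz.1.2 fun e => hc ?_⟩
    · rw [← hzc, ← e, h0]
    · rw [← hzc, e, h1]
  rw [accPt_iff_frequently] at hacc
  have heq := ha.eqOn_of_preconnected_of_frequently_eq (g := fun _ => c) analyticOnNhd_const
    isPreconnected_Ioo hz' (by
      rw [frequently_nhdsWithin_iff]
      exact hacc.mono fun y hy => ⟨hy.2.2, hy.1⟩)
  have hcl' : EqOn h (fun _ => c) (closure (Ioo 0 T)) := by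
    refine heq.of_subset_closure ?_ continuousOn_const subset_closure subset_rfl
    rwa [closure_Ioo hT.ne]
  have := hcl' (by rw [closure_Ioo hT.ne]; exact left_mem_Icc.2 hT.le : (0 : ℝ) ∈ _)
  exact hc (by rw [← h0, this])

variable {T α β : ℝ}

/-! ### Stability of BV under linear operations. -/

theorem IsBV.congr {u v : ℝ → ℝ} (hu : IsBV T u)
    (h : u =ᵐ[volume.restrict (Ioo 0 T)] v) : IsBV T v := by
  obtain ⟨h1, μ, ν, hμ, hν, h2⟩ := hu
  refine ⟨h1.congr h, μ, ν, hμ, hν, fun φ hφ => ?_⟩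
  rw [← h2 φ hφ]
  exact integral_congr_ae (h.mono fun x hx => by simp only [hx])

theorem IsBV.neg {u : ℝ → ℝ} (hu : IsBV T u) : IsBV T (fun x => -u x) := by
  obtain ⟨h1, μ, ν, hμ, hν, h2⟩ := hu
  refine ⟨h1.neg, ν, μ, hν, hμ, fun φ hφ => ?_⟩
  simp only [neg_mul]
  rw [integral_neg, h2 φ hφ]
  ring

theorem IsBV.add {u v : ℝ → ℝ} (hu : IsBV T u) (hv : IsBV T v) : IsBV T (fun x => u x + v x) := by
  obtain ⟨h1, μ, ν, hμ, hν, h2⟩ := hu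
  obtain ⟨h1', μ', ν', hμ', hν', h2'⟩ := hv
  refine ⟨h1.add h1', μ + μ', ν + ν', inferInstance, inferInstance, fun φ hφ => ?_⟩
  have hφ' : IsTestOn (Ioo 0 T) φ := hφ
  simp only [add_mul]
  rw [integral_add (hφ'.deriv.integrable_mul h1) (hφ'.deriv.integrable_mul h1'), h2 φ hφ,
    h2' φ hφ, integral_add_measure hφ'.integrable hφ'.integrable,
    integral_add_measure hφ'.integrable hφ'.integrable]
  ring

theorem IsBV.const_mul {u : ℝ → ℝ} (hu : IsBV T u) {c : ℝ} (hc : 0 ≤ c) :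
    IsBV T (fun x => c * u x) := by
  obtain ⟨h1, μ, ν, hμ, hν, h2⟩ := hu
  lift c to NNReal using hc
  refine ⟨h1.const_mul _, c • μ, c • ν, inferInstance, inferInstance, fun φ hφ => ?_⟩
  simp only [mul_assoc]
  rw [integral_const_mul, h2 φ hφ, integral_smul_nnreal_measure, integral_smul_nnreal_measure]
  simp only [NNReal.smul_def, smul_eq_mul]
  ring

/-! ### First order conditions at the minimizer. -/

/-- The constraints on the competitors in the definition of `TGV`. -/
def Admissible (T α β : ℝ) (v : ℝ → ℝ) : Prop :=
  IsTestOn (Ioo 0 T) v ∧ (∀ x ∈ Ioo 0 T, |v x| ≤ α) ∧ ∀ x ∈ Ioo 0 T, |deriv v x| ≤ β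

theorem TGV_le (hα : 0 < α) (hβ : 0 < β) {u : ℝ → ℝ} {M : ℝ}
    (h : ∀ v, Admissible T α β v → ∫ x in Ioo 0 T, u x * deriv (deriv v) x ≤ M) :
    TGV T α β u ≤ M := by
  refine csSup_le (tgvSet_nonempty hα hβ u) ?_
  rintro r ⟨v, h1, h2, h3, rfl⟩
  simpa [iteratedDeriv_succ] using h v ⟨h1, h2, h3⟩

theorem le_TGV (hβ : 0 < β) {u v : ℝ → ℝ} (hu : IsBV T u) (hv : Admissible T α β v) :
    ∫ x in Ioo 0 T, u x * deriv (deriv v) x ≤ TGV T α β u :=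
  le_csSup (bddAbove_tgvSet hβ hu) ⟨v, hv.1, hv.2.1, hv.2.2, by simp [iteratedDeriv_succ]⟩

theorem integrableOn_coe (w : L2 T) : IntegrableOn (w : ℝ → ℝ) (Ioo 0 T) :=
  (Lp.memLp w).integrable one_le_two

theorem inner_eq_integral (g w : L2 T) : inner ℝ g w = ∫ x in Ioo 0 T, g x * w x := by
  rw [L2.inner_def]
  exact integral_congr_ae (Eventually.of_forall fun x => by simp [mul_comm])

/-- The first order condition at a minimizer, in the direction `w`. -/
theorem inner_gradient_add_nonneg {f : L2 T → ℝ} (hf : Differentiable ℝ f) {u w : L2 T} {M : ℝ}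
    (hmin : IsMinOn (fun v : L2 T => f v + TGV T α β v) (BV T) u)
    (h : ∀ t : ℝ, 0 < t → t < 1 → u + t • w ∈ BV T ∧
      TGV T α β (u + t • w : L2 T) ≤ TGV T α β u + t * M) :
    0 ≤ inner ℝ (gradient f u) w + M := by
  have hd : HasDerivAt (fun t : ℝ => f (u + t • w)) (inner ℝ (gradient f u) w) 0 := by
    have h1 : HasFDerivAt f (InnerProductSpace.toDual ℝ (L2 T) (gradient f u))
        (u + (0 : ℝ) • w) := by
      rw [zero_smul, add_zero]
      exact (hf u).hasGradientAt.hasFDerivAt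
    have h2 : HasDerivAt (fun t : ℝ => u + t • w) w 0 := by
      simpa using ((hasDerivAt_id (0 : ℝ)).smul_const w).const_add u
    exact h1.comp_hasDerivAt (0 : ℝ) h2
  have hs := hasDerivWithinAt_iff_tendsto_slope.1 (hd.hasDerivWithinAt (s := Ioi 0))
  rw [sdiff_singleton_eq_self (by simp)] at hs
  -- Minimality gives $f(u+tw)-f(u)\ge\operatorname{TGV}(u)-\operatorname{TGV}(u+tw)\ge-tM$, so
  -- every slope is at least $-M$.
  suffices -M ≤ inner ℝ (gradient f u) w by linarith
  refine ge_of_tendsto hs ?_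
  filter_upwards [Ioo_mem_nhdsGT (zero_lt_one' ℝ)] with t ht
  obtain ⟨h1, h2⟩ := h t ht.1 ht.2
  have h3 := isMinOn_iff.1 hmin _ h1
  rw [slope_def_field, zero_smul, add_zero, sub_zero, le_div_iff₀ ht.1]
  linarith

theorem coe_add_smul (u w : L2 T) (t : ℝ) :
    (fun x => u x + t * w x) =ᵐ[volume.restrict (Ioo 0 T)] (u + t • w : L2 T) := by
  filter_upwards [Lp.coeFn_add u (t • w), Lp.coeFn_smul t w] with x h1 h2
  rw [h1, Pi.add_apply, h2, Pi.smul_apply, smul_eq_mul]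

theorem integral_coe_add_smul_mul (u w : L2 T) (t : ℝ) {φ : ℝ → ℝ} (hφ : IsTestOn (Ioo 0 T) φ) :
    ∫ x in Ioo 0 T, (u + t • w : L2 T) x * φ x =
      (∫ x in Ioo 0 T, u x * φ x) + t * ∫ x in Ioo 0 T, w x * φ x := by
  rw [← integral_const_mul, ← integral_add (hφ.integrable_mul (integrableOn_coe u))
    ((hφ.integrable_mul (integrableOn_coe w)).const_mul t)]
  refine integral_congr_ae ((coe_add_smul u w t).mono fun x hx => ?_)
  simp only
  rw [← hx]
  ring

theorem neg_mem_BV {w : L2 T} (hw : w ∈ BV T) : -w ∈ BV T :=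
  (IsBV.neg hw).congr (Lp.coeFn_neg w).symm

/-- Subadditivity of TGV: `M` dominates each pairing of `w''` with a competitor, so moving by `t •
w` raises TGV by at most `t * M`. -/
theorem inner_gradient_add_nonneg_of_mem_BV (hα : 0 < α) (hβ : 0 < β) {f : L2 T → ℝ}
    (hf : Differentiable ℝ f) {u w : L2 T} (hu : u ∈ BV T)
    (hmin : IsMinOn (fun v : L2 T => f v + TGV T α β v) (BV T) u) (hw : w ∈ BV T) {M : ℝ}
    (hM : ∀ v, Admissible T α β v → ∫ x in Ioo 0 T, w x * deriv (deriv v) x ≤ M) :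
    0 ≤ inner ℝ (gradient f u) w + M := by
  refine inner_gradient_add_nonneg hf hmin fun t ht _ => ⟨?_, TGV_le hα hβ fun v hv => ?_⟩
  · exact (IsBV.add hu (IsBV.const_mul hw ht.le)).congr (coe_add_smul u w t)
  · rw [integral_coe_add_smul_mul u w t hv.1.deriv.deriv]
    exact add_le_add (le_TGV hβ hu hv) (mul_le_mul_of_nonneg_left (hM v hv) ht.le)

theorem abs_inner_gradient_le (hα : 0 < α) (hβ : 0 < β) {f : L2 T → ℝ}
    (hf : Differentiable ℝ f) {u w : L2 T} (hu : u ∈ BV T)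
    (hmin : IsMinOn (fun v : L2 T => f v + TGV T α β v) (BV T) u) (hw : w ∈ BV T) {M : ℝ}
    (hM : ∀ v, Admissible T α β v → |∫ x in Ioo 0 T, w x * deriv (deriv v) x| ≤ M) :
    |inner ℝ (gradient f u) w| ≤ M := by
  have h1 := inner_gradient_add_nonneg_of_mem_BV hα hβ hf hu hmin hw
    fun v hv => (abs_le.1 (hM v hv)).2
  have h2 := inner_gradient_add_nonneg_of_mem_BV hα hβ hf hu hmin (neg_mem_BV hw) (M := M)
    fun v hv => by
      have e : ∫ x in Ioo 0 T, (-w : L2 T) x * deriv (deriv v) x =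
          -∫ x in Ioo 0 T, w x * deriv (deriv v) x := by
        rw [← integral_neg]
        refine integral_congr_ae ((Lp.coeFn_neg w).mono fun x hx => ?_)
        simp only
        rw [hx, Pi.neg_apply, neg_mul]
      rw [e]
      linarith [(abs_le.1 (hM v hv)).1]
  rw [inner_neg_right] at h2
  exact abs_le.2 ⟨by linarith, by linarith⟩

/-- Shrinking `u` to `(1 - t) • u` lowers TGV by the fraction `t` by homogeneity. This is the half
of the optimality relation that makes the dual variable a maximizer. -/
theorem inner_gradient_add_TGV_le (hα : 0 < α) (hβ : 0 < β) {f : L2 T → ℝ}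
    (hf : Differentiable ℝ f) {u : L2 T} (hu : u ∈ BV T)
    (hmin : IsMinOn (fun v : L2 T => f v + TGV T α β v) (BV T) u) :
    inner ℝ (gradient f u) u + TGV T α β u ≤ 0 := by
  have h := inner_gradient_add_nonneg hf hmin (w := -u) (M := -TGV T α β u) fun t ht ht1 => by
    have e : u + t • -u = (0 : L2 T) + (1 - t) • u := by module
    rw [e]
    refine ⟨?_, TGV_le hα hβ fun v hv => ?_⟩
    · refine (IsBV.const_mul hu (sub_nonneg.2 ht1.le)).congr ?_
      have := coe_add_smul 0 u (1 - t)
      filter_upwards [this, Lp.coeFn_zero ℝ 2 (volume.restrict (Ioo 0 T))] with x h1 h2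
      rw [← h1, h2, Pi.zero_apply, zero_add]
    · rw [integral_coe_add_smul_mul 0 u _ hv.1.deriv.deriv]
      have e0 : ∫ x in Ioo 0 T, (0 : L2 T) x * deriv (deriv v) x = 0 := by
        refine integral_eq_zero_of_ae ?_
        filter_upwards [Lp.coeFn_zero ℝ 2 (volume.restrict (Ioo 0 T))] with x h2
        rw [h2, Pi.zero_apply, zero_mul]
      rw [e0]
      nlinarith [le_TGV hβ hu hv]
  rw [inner_neg_right] at h
  linarith

/-! ### Cutoffs and truncation of the dual variable. -/

theorem deriv_eq_zero_of_eqOn_const {U : Set ℝ} (hU : IsOpen U) {φ : ℝ → ℝ} {c : ℝ}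
    (h : EqOn φ (fun _ => c) U) : EqOn (deriv φ) (fun _ => 0) U := fun x hx => by
  rw [(h.eventuallyEq_of_mem (hU.mem_nhds hx)).deriv_eq, deriv_const]

theorem exists_smoothTransition_deriv_bound :
    ∃ C, 0 ≤ C ∧ ∀ x, |deriv Real.smoothTransition x| ≤ C ∧
      |deriv (deriv Real.smoothTransition) x| ≤ C := by
  have hs : ContDiff ℝ ∞ Real.smoothTransition := Real.smoothTransition.contDiff
  have hs1 := (contDiff_infty_iff_deriv.1 hs).2
  have hs2 := (contDiff_infty_iff_deriv.1 hs1).2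
  have h0 : EqOn Real.smoothTransition (fun _ => 0) (Iio 0) := fun x hx =>
    Real.smoothTransition.zero_of_nonpos (le_of_lt hx)
  have h1 : EqOn Real.smoothTransition (fun _ => 1) (Ioi 1) := fun x hx =>
    Real.smoothTransition.one_of_one_le (le_of_lt hx)
  have h0' := deriv_eq_zero_of_eqOn_const isOpen_Iio h0
  have h1' := deriv_eq_zero_of_eqOn_const isOpen_Ioi h1
  have h0'' := deriv_eq_zero_of_eqOn_const isOpen_Iio h0'
  have h1'' := deriv_eq_zero_of_eqOn_const isOpen_Ioi h1'
  have key : ∀ φ : ℝ → ℝ, Continuous φ → EqOn φ (fun _ => 0) (Iio 0) →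
      EqOn φ (fun _ => 0) (Ioi 1) → ∃ C, 0 ≤ C ∧ ∀ x, |φ x| ≤ C := by
    intro φ hφ h h'
    obtain ⟨C, hC⟩ := (isCompact_Icc (a := (0 : ℝ)) (b := 1)).exists_bound_of_continuousOn
      hφ.continuousOn
    have hC0 : 0 ≤ C := (norm_nonneg _).trans (hC 0 (by simp))
    refine ⟨C, hC0, fun x => ?_⟩
    rcases lt_or_ge x 0 with hx | hx
    · simpa [h hx] using hC0
    rcases lt_or_ge 1 x with hx' | hx'
    · simpa [h' hx'] using hC0
    exact hC x ⟨hx, hx'⟩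
  obtain ⟨C, hC, hb⟩ := key _ hs1.continuous h0' h1'
  obtain ⟨C', hC', hb'⟩ := key _ hs2.continuous h0'' h1''
  exact ⟨C + C', by positivity, fun x => ⟨(hb x).trans (by linarith), (hb' x).trans (by linarith)⟩⟩

/-- Cutoff functions at distance `r` from the endpoints of `(0,T)`. -/
theorem exists_cutoff (T : ℝ) : ∃ C, 0 ≤ C ∧ ∀ r, 0 < r → r < T / 2 → ∃ χ : ℝ → ℝ,
    IsTestOn (Ioo 0 T) χ ∧ (∀ x, 0 ≤ χ x ∧ χ x ≤ 1) ∧ EqOn χ (fun _ => 1) (Ioo r (T - r)) ∧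
      ∀ x, |deriv χ x| ≤ C / r ∧ |deriv (deriv χ) x| ≤ C / r ^ 2 := by
  obtain ⟨C, hC, hb⟩ := exists_smoothTransition_deriv_bound
  -- The worst case is the second derivative: a factor `4 / r ^ 2` times two terms bounded by `C`.
  refine ⟨8 * C, by positivity, fun r hr hrT => ?_⟩
  set ρ := Real.smoothTransition with hρ
  have hs : ContDiff ℝ ∞ ρ := Real.smoothTransition.contDiff
  have hs1 := contDiff_infty_iff_deriv.1 hs
  have hs2 := contDiff_infty_iff_deriv.1 hs1.2
  have hl : ∀ x, HasDerivAt (fun x : ℝ => 2 * x / r - 1) (2 / r) x := fun x => by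
    simpa using (((hasDerivAt_id x).const_mul 2).div_const r).sub_const 1
  have hl' : ∀ x, HasDerivAt (fun x : ℝ => 2 * (T - x) / r - 1) (-(2 / r)) x := fun x => by
    have := ((((hasDerivAt_id x).const_sub T).const_mul 2).div_const r).sub_const 1
    simpa [neg_div] using this
  have hd : ∀ x, HasDerivAt (fun x => ρ (2 * x / r - 1) + ρ (2 * (T - x) / r - 1) - 1)
      (2 / r * (deriv ρ (2 * x / r - 1) - deriv ρ (2 * (T - x) / r - 1))) x := fun x => by
    have h1 := (hs1.1 (2 * x / r - 1)).hasDerivAt.comp x (hl x)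
    have h2 := (hs1.1 (2 * (T - x) / r - 1)).hasDerivAt.comp x (hl' x)
    exact ((h1.add h2).sub_const 1).congr_deriv (by ring)
  have hd2 : ∀ x, HasDerivAt
      (fun x => 2 / r * (deriv ρ (2 * x / r - 1) - deriv ρ (2 * (T - x) / r - 1)))
      (4 / r ^ 2 * (deriv (deriv ρ) (2 * x / r - 1) + deriv (deriv ρ) (2 * (T - x) / r - 1))) x :=
    fun x => by
    have h1 := (hs2.1 (2 * x / r - 1)).hasDerivAt.comp x (hl x)
    have h2 := (hs2.1 (2 * (T - x) / r - 1)).hasDerivAt.comp x (hl' x)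
    exact ((h1.sub h2).const_mul (2 / r)).congr_deriv (by field_simp; ring)
  have hd' := funext fun x => (hd x).deriv
  have hdle : ∀ x y : ℝ, |deriv ρ x - deriv ρ y| ≤ 2 * C := fun x y => by
    have := abs_sub (deriv ρ x) (deriv ρ y)
    linarith [(hb x).1, (hb y).1]
  have hd2le : ∀ x y : ℝ, |deriv (deriv ρ) x + deriv (deriv ρ) y| ≤ 2 * C := fun x y => by
    have := abs_add_le (deriv (deriv ρ) x) (deriv (deriv ρ) y)
    linarith [(hb x).2, (hb y).2]
  have hone : ∀ y, r ≤ y → ρ (2 * y / r - 1) = 1 := fun y hy => by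
    refine Real.smoothTransition.one_of_one_le ?_
    have : 2 ≤ 2 * y / r := by rw [le_div_iff₀ hr]; linarith
    linarith
  have hzero : ∀ y, y ≤ r / 2 → ρ (2 * y / r - 1) = 0 := fun y hy => by
    refine Real.smoothTransition.zero_of_nonpos ?_
    have : 2 * y / r ≤ 1 := by rw [div_le_iff₀ hr]; linarith
    linarith
  -- A rising and a falling transition minus one; as `r < T / 2`, at each point at least one of the
  -- two equals `1`.
  refine ⟨fun x => ρ (2 * x / r - 1) + ρ (2 * (T - x) / r - 1) - 1,
    isTestOn_Ioo_of_eq_zero (c := r / 2) (d := T - r / 2) ?_ (by positivity) (by linarith) ?_,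
    fun x => ?_, fun x hx => ?_, fun x => ⟨?_, ?_⟩⟩
  · refine ((hs.comp ?_).add (hs.comp ?_)).sub contDiff_const <;> fun_prop
  · intro x hx
    rcases le_or_gt x (r / 2) with h | h
    · rw [hzero x h, hone (T - x) (by linarith)]; ring
    · have h' : T - r / 2 < x := by
        by_contra hh
        exact hx ⟨h.le, not_lt.1 hh⟩
      rw [hzero (T - x) (by linarith), hone x (by linarith)]; ring
  · have h1 := Real.smoothTransition.nonneg (2 * x / r - 1)
    have h2 := Real.smoothTransition.nonneg (2 * (T - x) / r - 1)
    have h3 := Real.smoothTransition.le_one (2 * x / r - 1)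
    have h4 := Real.smoothTransition.le_one (2 * (T - x) / r - 1)
    rw [← hρ] at h1 h2 h3 h4
    beta_reduce
    rcases le_total x (T / 2) with h | h
    · rw [hone (T - x) (by linarith)]
      exact ⟨by linarith, by linarith⟩
    · rw [hone x (by linarith)]
      exact ⟨by linarith, by linarith⟩
  · simp only
    rw [hone x hx.1.le, hone (T - x) (by linarith [hx.2])]; ring
  · rw [(hd x).deriv, abs_mul, abs_of_pos (by positivity)]
    calc _ ≤ 2 / r * (2 * C) := mul_le_mul_of_nonneg_left (hdle _ _) (by positivity)
      _ ≤ 8 * C / r := by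
          rw [div_mul_eq_mul_div]
          exact div_le_div_of_nonneg_right (by linarith) hr.le
  · rw [hd', (hd2 x).deriv, abs_mul, abs_of_pos (by positivity)]
    calc _ ≤ 4 / r ^ 2 * (2 * C) := mul_le_mul_of_nonneg_left (hd2le _ _) (by positivity)
      _ = 8 * C / r ^ 2 := by ring

theorem IsTestOn.mul_of_contDiffOn {U : Set ℝ} (hU : IsOpen U) {χ P : ℝ → ℝ}
    (hχ : IsTestOn U χ) (hP : ContDiffOn ℝ ∞ P U) : IsTestOn U (fun x => χ x * P x) := by
  have hsub : tsupport (fun x => χ x * P x) ⊆ tsupport χ := tsupport_mul_subset_left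
  refine ⟨contDiff_iff_contDiffAt.2 fun x => ?_, hχ.2.1.mul_right, hsub.trans hχ.2.2⟩
  by_cases hx : x ∈ U
  · exact hχ.1.contDiffAt.mul (hP.contDiffAt (hU.mem_nhds hx))
  · have : (fun x => χ x * P x) =ᶠ[𝓝 x] fun _ => 0 :=
      notMem_tsupport_iff_eventuallyEq.1 fun hx' => hx (hχ.2.2 (hsub hx'))
    exact contDiffAt_const.congr_of_eventuallyEq this

theorem IsTestOn.deriv_deriv_mul {U : Set ℝ} (hU : IsOpen U) {χ P : ℝ → ℝ}
    (hχ : IsTestOn U χ) (hP : ContDiffOn ℝ ∞ P U) {x : ℝ} (hx : x ∈ U) :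
    _root_.deriv (_root_.deriv (fun x => χ x * P x)) x =
      _root_.deriv (_root_.deriv χ) x * P x + 2 * (_root_.deriv χ x * _root_.deriv P x) +
        χ x * _root_.deriv (_root_.deriv P) x := by
  have hP1 : ∀ x ∈ U, DifferentiableAt ℝ P x := fun x hx =>
    (hP.contDiffAt (hU.mem_nhds hx)).differentiableAt (by simp)
  have hP2 : DifferentiableAt ℝ (_root_.deriv P) x :=
    (((contDiffOn_infty_iff_deriv_of_isOpen hU).1 hP).2.contDiffAt
      (hU.mem_nhds hx)).differentiableAt (by simp)
  have h1 : _root_.deriv (fun x => χ x * P x) =ᶠ[𝓝 x]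
      fun x => _root_.deriv χ x * P x + χ x * _root_.deriv P x :=
    eventually_of_mem (hU.mem_nhds hx) fun y hy =>
      deriv_fun_mul (hχ.differentiable y) (hP1 y hy)
  rw [h1.deriv_eq, deriv_fun_add ((hχ.deriv.differentiable x).fun_mul (hP1 x hx))
    ((hχ.differentiable x).fun_mul hP2), deriv_fun_mul (hχ.deriv.differentiable x) (hP1 x hx),
    deriv_fun_mul (hχ.differentiable x) hP2]
  ring

/-- Weighted Young inequality for the truncation error, with `c` the cutoff and `R` the terms in
which it is differentiated. In a boundary layer of width `r`, `R` is of order $r^{-1/2}$, so $\int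
R^2$ is bounded but not small: the small `η` handles it, while $u^2/\eta$ has small integral over a
thin layer. -/
theorem abs_mul_add_le_of_weight {u g c R η : ℝ} (hη : 0 < η) (h0 : 0 ≤ c) (h1 : c ≤ 1) :
    |u * (R + c * -g) + g * u| ≤ |g * u| + u ^ 2 / η + η * R ^ 2 := by
  have e1 : u * (R + c * -g) + g * u = u * R + (1 - c) * (g * u) := by ring
  have h2 : |(1 - c) * (g * u)| ≤ |g * u| := by
    rw [abs_mul, abs_of_nonneg (by linarith)]
    exact mul_le_of_le_one_left (abs_nonneg _) (by linarith)
  have h3 : |u * R| ≤ u ^ 2 / η + η * R ^ 2 := by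
    have e2 : u ^ 2 / η + η * R ^ 2 = (u ^ 2 + (η * R) ^ 2) / η := by field_simp
    have e3 : |u * R| * η = |u * (η * R)| := by
      rw [mul_left_comm, abs_mul η, abs_of_pos hη, mul_comm]
    rw [e2, le_div_iff₀ hη, e3, abs_le]
    constructor <;> nlinarith [sq_nonneg (u + η * R), sq_nonneg (u - η * R)]
  rw [e1]
  linarith [abs_add_le (u * R) ((1 - c) * (g * u))]

theorem volume_restrict_near_endpoints_le (T r : ℝ) :
    (volume.restrict (Ioo 0 T)) (Iic r ∪ Ici (T - r)) ≤ ENNReal.ofReal r + ENNReal.ofReal r := by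
  rw [Measure.restrict_apply (measurableSet_Iic.union measurableSet_Ici)]
  calc volume ((Iic r ∪ Ici (T - r)) ∩ Ioo 0 T) ≤ volume (Icc 0 r ∪ Icc (T - r) T) := by
        refine measure_mono ?_
        rintro x ⟨h | h, hx⟩
        · exact Or.inl ⟨hx.1.le, h⟩
        · exact Or.inr ⟨h, hx.2.le⟩
    _ ≤ _ := by
        refine (measure_union_le _ _).trans ?_
        simp

theorem integral_indicator_near_endpoints_le {r : ℝ} (hr : 0 ≤ r) {h : ℝ → ℝ}
    (hint : Integrable h (volume.restrict (Ioo 0 T))) {K : ℝ} (hK : 0 ≤ K) :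
    ∫ x in Ioo 0 T, (Iic r ∪ Ici (T - r)).indicator (fun x => h x + K) x ≤
      (∫ x in Iic r ∪ Ici (T - r), h x ∂volume.restrict (Ioo 0 T)) + 2 * r * K := by
  rw [integral_indicator (measurableSet_Iic.union measurableSet_Ici),
    integral_add hint.integrableOn (integrable_const _), setIntegral_const, smul_eq_mul]
  have := ENNReal.toReal_mono (by simp) (volume_restrict_near_endpoints_le T r)
  rw [ENNReal.toReal_add (by simp) (by simp), ENNReal.toReal_ofReal hr] at this
  have hm : (volume.restrict (Ioo 0 T)).real (Iic r ∪ Ici (T - r)) ≤ 2 * r := by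
    rw [measureReal_def]
    linarith
  gcongr

/-- A smooth function on `(0,T)` which is small near the endpoints can be truncated to a test
function, with control on the second derivative against square integrable functions. -/
theorem exists_test_approx (hT : 0 < T) (hβ : 0 < β) {u g P : ℝ → ℝ} {G : ℝ}
    (hu : MemLp u 2 (volume.restrict (Ioo 0 T))) (hg : MemLp g 2 (volume.restrict (Ioo 0 T)))
    (hP : ContDiffOn ℝ ∞ P (Ioo 0 T))
    (hP2 : ∀ᵐ x ∂volume.restrict (Ioo 0 T), deriv (deriv P) x = -g x)
    (hPβ : ∀ x ∈ Ioo 0 T, |deriv P x| ≤ β)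
    (hend : ∀ r, 0 < r → ∀ x ∈ Ioo 0 T, (x ≤ r ∨ T - r ≤ x) →
      |deriv P x| ≤ G * √r ∧ |P x| ≤ G * (r * √r))
    {e : ℝ} (he : 0 < e) {r₀ : ℝ} (hr₀ : 0 < r₀) :
    ∃ v, IsTestOn (Ioo 0 T) v ∧ EqOn v P (Ioo r₀ (T - r₀)) ∧ (∀ x ∈ Ioo 0 T, |v x| ≤ |P x|) ∧
      (∀ x ∈ Ioo 0 T, |deriv v x| ≤ β) ∧
      |(∫ x in Ioo 0 T, u x * deriv (deriv v) x) + ∫ x in Ioo 0 T, g x * u x| ≤ e := by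
  obtain ⟨C, hC, hcut⟩ := exists_cutoff T
  set H := 3 * C * G with hH
  -- Chosen before `r`, so that `2 * η * H ^ 2 ≤ e / 2` whatever the width of the layer.
  set η := e / (4 * (H ^ 2 + 1)) with hη
  have hη0 : 0 < η := by positivity
  set h : ℝ → ℝ := fun x => |g x * u x| + u x ^ 2 / η with hh
  have hgu : Integrable (fun x => g x * u x) (volume.restrict (Ioo 0 T)) := hg.integrable_mul hu
  have hint : Integrable h (volume.restrict (Ioo 0 T)) := hgu.abs.add (hu.integrable_sq.div_const η)
  have hlim := hint.tendsto_setIntegral_nhds_zero (l := 𝓝[>] (0 : ℝ))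
    (s := fun r => Iic r ∪ Ici (T - r)) (by
      refine tendsto_of_tendsto_of_tendsto_of_le_of_le tendsto_const_nhds ?_ (fun _ => zero_le)
        fun r => volume_restrict_near_endpoints_le T r
      have hc : Continuous fun r : ℝ => ENNReal.ofReal r + ENNReal.ofReal r :=
        ENNReal.continuous_ofReal.add ENNReal.continuous_ofReal
      simpa using (hc.tendsto 0).mono_left nhdsWithin_le_nhds)
  -- This quantity bounds the derivative of the truncation in the boundary layer, so it must fall
  -- below `β`.
  have hlim2 : Tendsto (fun r : ℝ => (C + 1) * G * √r) (𝓝[>] 0) (𝓝 0) := by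
    have hc : Continuous fun r : ℝ => (C + 1) * G * √r := by fun_prop
    simpa using (hc.tendsto 0).mono_left nhdsWithin_le_nhds
  obtain ⟨r, hr1, hr2, hr⟩ := ((hlim.eventually (gt_mem_nhds (half_pos he))).and
    ((hlim2.eventually (gt_mem_nhds hβ)).and
      (Ioo_mem_nhdsGT (lt_min hr₀ (half_pos hT))))).exists
  have hr0 : 0 < r := hr.1
  have hrr₀ : r < r₀ := hr.2.trans_le (min_le_left _ _)
  have hrT : r < T / 2 := hr.2.trans_le (min_le_right _ _)
  obtain ⟨χ, hχ, hχ01, hχ1, hχb⟩ := hcut r hr0 hrT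
  have hχ1' := deriv_eq_zero_of_eqOn_const isOpen_Ioo hχ1
  have hχ1'' := deriv_eq_zero_of_eqOn_const isOpen_Ioo hχ1'
  have hPat : ∀ x ∈ Ioo 0 T, ContDiffAt ℝ ∞ P x := fun x hx =>
    hP.contDiffAt (isOpen_Ioo.mem_nhds hx)
  have hP1 : ∀ x ∈ Ioo 0 T, DifferentiableAt ℝ P x := fun x hx =>
    (hPat x hx).differentiableAt (by simp)
  have hv := hχ.mul_of_contDiffOn isOpen_Ioo hP
  have hd1 : ∀ x ∈ Ioo 0 T, deriv (fun x => χ x * P x) x = deriv χ x * P x + χ x * deriv P x :=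
    fun x hx => deriv_fun_mul (hχ.differentiable x) (hP1 x hx)
  have hd2 : ∀ x ∈ Ioo 0 T, deriv (deriv (fun x => χ x * P x)) x =
      deriv (deriv χ) x * P x + 2 * (deriv χ x * deriv P x) + χ x * deriv (deriv P) x :=
    fun x hx => hχ.deriv_deriv_mul isOpen_Ioo hP hx
  have hsr : 0 < √r := Real.sqrt_pos.2 hr0
  have hsq : √r * √r = r := Real.mul_self_sqrt hr0.le
  have hcase : ∀ x, x ∈ Ioo r (T - r) ∨ (x ≤ r ∨ T - r ≤ x) := by
    intro x
    rcases le_or_gt x r with h1 | h1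
    · exact Or.inr (Or.inl h1)
    · rcases le_or_gt (T - r) x with h2 | h2
      · exact Or.inr (Or.inr h2)
      · exact Or.inl ⟨h1, h2⟩
  refine ⟨fun x => χ x * P x, hv, fun x hx => ?_, fun x _ => ?_, fun x hx => ?_, ?_⟩
  · have : χ x = 1 := hχ1 ⟨hrr₀.trans hx.1, hx.2.trans (by linarith)⟩
    simp [this]
  · rw [abs_mul, abs_of_nonneg (hχ01 x).1]
    exact mul_le_of_le_one_left (abs_nonneg _) (hχ01 x).2
  · rw [hd1 x hx]
    rcases hcase x with hm | hm
    · rw [hχ1' hm, hχ1 hm]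
      simpa using hPβ x hx
    · obtain ⟨hb1, hb2⟩ := hend r hr0 x hx hm
      calc |deriv χ x * P x + χ x * deriv P x|
          ≤ |deriv χ x| * |P x| + |χ x| * |deriv P x| := by
            rw [← abs_mul, ← abs_mul]; exact abs_add_le _ _
        _ ≤ C / r * (G * (r * √r)) + 1 * (G * √r) := by
            have := (hχb x).1
            have h3 : |χ x| ≤ 1 := by rw [abs_of_nonneg (hχ01 x).1]; exact (hχ01 x).2
            gcongr
        _ = (C + 1) * G * √r := by field_simp
        _ ≤ β := hr2.le
  · set A : Set ℝ := Iic r ∪ Ici (T - r) with hA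
    have hAm : MeasurableSet A := measurableSet_Iic.union measurableSet_Ici
    rw [← integral_add (hv.deriv.deriv.integrable_mul (hu.integrable one_le_two)) hgu,
      ← Real.norm_eq_abs]
    have hbint : Integrable (fun x => h x + η * (H ^ 2 / r)) (volume.restrict (Ioo 0 T)) :=
      hint.add (integrable_const _)
    refine (norm_integral_le_of_norm_le (hbint.indicator hAm) ?_).trans ?_
    · filter_upwards [hP2, ae_restrict_mem measurableSet_Ioo] with x hx2 hx
      rw [hd2 x hx, hx2, Real.norm_eq_abs]
      rcases hcase x with hm | hm
      -- Away from the layer the truncation is `P`, and `u * P'' + g * u` cancels.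
      · rw [hχ1' hm, hχ1'' hm, hχ1 hm, indicator_of_notMem]
        · refine le_of_eq ?_
          rw [abs_eq_zero]
          ring
        · rintro (h' | h')
          · exact absurd hm.1 (not_lt.2 h')
          · exact absurd hm.2 (not_lt.2 h')
      · rw [indicator_of_mem (show x ∈ A from hm)]
        obtain ⟨hb1, hb2⟩ := hend r hr0 x hx hm
        have hR : |deriv (deriv χ) x * P x + 2 * (deriv χ x * deriv P x)| ≤ H / √r := by
          calc |deriv (deriv χ) x * P x + 2 * (deriv χ x * deriv P x)|
              ≤ |deriv (deriv χ) x| * |P x| + 2 * (|deriv χ x| * |deriv P x|) := by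
                refine (abs_add_le _ _).trans (le_of_eq ?_)
                rw [abs_mul, abs_mul, abs_mul, abs_two]
            _ ≤ C / r ^ 2 * (G * (r * √r)) + 2 * (C / r * (G * √r)) := by
                have h1 := (hχb x).1
                have h2 := (hχb x).2
                gcongr
            _ = 3 * C * G * (√r / r) := by field_simp; ring
            _ = H / √r := by
                rw [hH, mul_div_assoc', div_eq_div_iff hr0.ne' hsr.ne', mul_assoc, hsq]
        set R := deriv (deriv χ) x * P x + 2 * (deriv χ x * deriv P x) with hRdef
        have hRsq : R ^ 2 ≤ H ^ 2 / r := by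
          rw [← sq_abs R]
          calc |R| ^ 2 ≤ (H / √r) ^ 2 := by gcongr
            _ = H ^ 2 / r := by rw [div_pow, Real.sq_sqrt hr0.le]
        have h1 := abs_mul_add_le_of_weight (u := u x) (g := g x) (R := R) hη0 (hχ01 x).1 (hχ01 x).2
        have h4 : η * R ^ 2 ≤ η * (H ^ 2 / r) := by gcongr
        simp only [hh]
        linarith
    · refine (integral_indicator_near_endpoints_le hr0.le hint (by positivity)).trans ?_
      have hk : 2 * r * (η * (H ^ 2 / r)) ≤ e / 2 := by
        calc 2 * r * (η * (H ^ 2 / r)) = 2 * (η * H ^ 2) := by field_simp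
          _ ≤ e / 2 := by
            have : e * H ^ 2 / (4 * (H ^ 2 + 1)) ≤ e / 4 := by
              rw [div_le_div_iff₀ (by positivity) (by norm_num)]
              nlinarith
            rw [hη, div_mul_eq_mul_div]
            linarith
      linarith

/-! ### Jumps and ramps as test directions. -/

theorem setIntegral_indicator_mul {y : ℝ} (hy : y ∈ Ico 0 T) (F ψ : ℝ → ℝ) :
    ∫ x in Ioo 0 T, (Ioo y T).indicator F x * ψ x = ∫ x in y..T, F x * ψ x := by
  have e : ∀ x, (Ioo y T).indicator F x * ψ x = (Ioo y T).indicator (fun x => F x * ψ x) x :=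
    fun x => by by_cases hx : x ∈ Ioo y T <;> simp [hx]
  simp only [e]
  rw [setIntegral_indicator measurableSet_Ioo, intervalIntegral.integral_of_le hy.2.le,
    integral_Ioc_eq_integral_Ioo, inter_eq_self_of_subset_right (Ioo_subset_Ioo_left hy.1)]

namespace IsTestOn

variable {φ : ℝ → ℝ}

/-- With `φ = deriv v`, the second derivative of a jump becomes evaluation of `-deriv v` at `y`,
which the bound `β` controls; one more integration does the same for a ramp, `v` and `α`. -/
theorem integral_jump (hφ : IsTestOn (Ioo 0 T) φ) (y : ℝ) :
    ∫ x in y..T, 1 * _root_.deriv φ x = -φ y := by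
  simp only [one_mul]
  rw [intervalIntegral.integral_deriv_eq_sub (fun x _ => hφ.differentiable x)
    (hφ.deriv.continuous.intervalIntegrable _ _), hφ.eq_zero (x := T) (by simp)]
  ring

theorem integral_ramp (hφ : IsTestOn (Ioo 0 T) φ) (y : ℝ) :
    ∫ x in y..T, (x - y) * _root_.deriv φ x = -∫ x in y..T, φ x := by
  rw [intervalIntegral.integral_mul_deriv_eq_deriv_mul (u := fun x => x - y)
    (u' := fun _ => 1)
    (fun x _ => (hasDerivAt_id x).sub_const y) (fun x _ => (hφ.differentiable x).hasDerivAt)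
    (continuous_const.intervalIntegrable _ _) (hφ.deriv.continuous.intervalIntegrable _ _),
    hφ.eq_zero (x := T) (by simp)]
  simp

end IsTestOn

/-- The ramp starting at `y`. -/
noncomputable def ramp (T y : ℝ) : ℝ → ℝ := (Ioo y T).indicator fun x => x - y

theorem memLp_jump (T y : ℝ) : MemLp (jump T y) 2 (volume.restrict (Ioo 0 T)) :=
  (memLp_const 1).indicator measurableSet_Ioo

theorem memLp_ramp {y : ℝ} (hy : y ∈ Ico 0 T) :
    MemLp (ramp T y) 2 (volume.restrict (Ioo 0 T)) := by
  refine MemLp.indicator measurableSet_Ioo (MemLp.of_bound (by fun_prop) T ?_)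
  filter_upwards [ae_restrict_mem measurableSet_Ioo] with x hx
  rw [Real.norm_eq_abs, abs_le]
  constructor <;> linarith [hx.1, hx.2, hy.1, hy.2]

theorem isBV_jump {y : ℝ} (hy : y ∈ Ico 0 T) : IsBV T (jump T y) := by
  refine ⟨(memLp_jump T y).integrable one_le_two, Measure.dirac y, 0, inferInstance, inferInstance,
    fun φ hφ => ?_⟩
  have hφ' : IsTestOn (Ioo 0 T) φ := hφ
  rw [jump, setIntegral_indicator_mul hy, hφ'.integral_jump]
  simp

theorem isBV_ramp {y : ℝ} (hy : y ∈ Ico 0 T) : IsBV T (ramp T y) := by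
  refine ⟨(memLp_ramp hy).integrable one_le_two, volume.restrict (Ioc y T), 0, inferInstance,
    inferInstance, fun φ hφ => ?_⟩
  have hφ' : IsTestOn (Ioo 0 T) φ := hφ
  rw [ramp, setIntegral_indicator_mul hy, hφ'.integral_ramp, intervalIntegral.integral_of_le hy.2.le]
  simp

theorem abs_integral_gradient_mul_le (hα : 0 < α) (hβ : 0 < β) {f : L2 T → ℝ}
    (hf : Differentiable ℝ f) {u : L2 T} (hu : u ∈ BV T)
    (hmin : IsMinOn (fun v : L2 T => f v + TGV T α β v) (BV T) u) {w : ℝ → ℝ}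
    (hw : MemLp w 2 (volume.restrict (Ioo 0 T))) (hwBV : IsBV T w) {M : ℝ}
    (hM : ∀ v, Admissible T α β v → |∫ x in Ioo 0 T, w x * deriv (deriv v) x| ≤ M) :
    |∫ x in Ioo 0 T, w x * (gradient f u : L2 T) x| ≤ M := by
  have h := abs_inner_gradient_le (w := hw.toLp w) hα hβ hf hu hmin
    (hwBV.congr hw.coeFn_toLp.symm) (M := M) fun v hv => by
      have e : ∫ x in Ioo 0 T, hw.toLp w x * deriv (deriv v) x =
          ∫ x in Ioo 0 T, w x * deriv (deriv v) x :=
        integral_congr_ae (hw.coeFn_toLp.mono fun x hx => by simp only [hx])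
      rw [e]
      exact hM v hv
  rw [inner_eq_integral] at h
  have e : ∫ x in Ioo 0 T, (gradient f u : L2 T) x * hw.toLp w x =
      ∫ x in Ioo 0 T, w x * (gradient f u : L2 T) x :=
    integral_congr_ae (hw.coeFn_toLp.mono fun x hx => by simp only [hx, mul_comm])
  rwa [e] at h

/-! ### Primitives of integrable functions. -/

section Primitive

variable {g : ℝ → ℝ}

theorem intervalIntegrable_of_integrableOn (hg : IntegrableOn g (Ioo 0 T)) {a b : ℝ} (ha : 0 ≤ a)
    (hab : a ≤ b) (hb : b ≤ T) : IntervalIntegrable g volume a b := by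
  rw [intervalIntegrable_iff_integrableOn_Ioo_of_le hab]
  exact hg.mono_set (Ioo_subset_Ioo ha hb)

theorem continuousOn_primitive_Icc (hT : 0 ≤ T) (hg : IntegrableOn g (Ioo 0 T)) :
    ContinuousOn (fun x => ∫ t in (0 : ℝ)..x, g t) (Icc 0 T) := by
  have h := intervalIntegral.continuousOn_primitive_interval (a := 0) (b := T) (f := g)
    (μ := volume)
  rw [uIcc_of_le hT] at h
  exact h ((integrableOn_Icc_iff_integrableOn_Ioo).2 hg)

theorem primitive_sub_primitive (hg : IntegrableOn g (Ioo 0 T)) {x : ℝ} (hx : x ∈ Icc 0 T) :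
    ∫ t in x..T, g t = (∫ t in (0 : ℝ)..T, g t) - ∫ t in (0 : ℝ)..x, g t := by
  rw [← intervalIntegral.integral_add_adjacent_intervals
    (intervalIntegrable_of_integrableOn hg le_rfl hx.1 hx.2)
    (intervalIntegrable_of_integrableOn hg hx.1 hx.2 le_rfl)]
  ring

theorem ae_deriv_primitive_eq (hT : 0 ≤ T) (hg : IntegrableOn g (Ioo 0 T)) :
    ∀ᵐ x ∂volume.restrict (Ioo 0 T), deriv (fun x => ∫ t in (0 : ℝ)..x, g t) x = g x := by
  rw [ae_restrict_iff' measurableSet_Ioo]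
  filter_upwards [(intervalIntegrable_of_integrableOn hg le_rfl hT le_rfl).ae_hasDerivAt_integral]
    with x hx hxT
  rw [uIcc_of_le hT] at hx
  exact (hx (Ioo_subset_Icc_self hxT) 0 (left_mem_Icc.2 hT)).deriv

/-- Integration by parts. Differentiability of the primitive throughout the open interval allows `g`
to be replaced a.e. by a genuine derivative. -/
theorem integral_ramp_mul (hg : IntegrableOn g (Ioo 0 T))
    (hd : DifferentiableOn ℝ (fun x => ∫ t in (0 : ℝ)..x, g t) (Ioo 0 T)) {y : ℝ}
    (hy : y ∈ Ico 0 T) :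
    ∫ x in y..T, (x - y) * g x =
      (T - y) * (∫ t in (0 : ℝ)..T, g t) - ∫ x in y..T, ∫ t in (0 : ℝ)..x, g t := by
  have hT : 0 ≤ T := hy.1.trans hy.2.le
  set p := fun x => ∫ t in (0 : ℝ)..x, g t with hp
  have hae := ae_deriv_primitive_eq hT hg
  have hae' : ∀ᵐ x ∂volume.restrict (Ioo y T), deriv p x = g x :=
    ae_restrict_of_ae_restrict_of_subset (Ioo_subset_Ioo_left hy.1) hae
  have hgi := intervalIntegrable_of_integrableOn hg hy.1 hy.2.le le_rfl
  have hpi : IntervalIntegrable (deriv p) volume y T := by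
    rw [intervalIntegrable_iff_integrableOn_Ioo_of_le hy.2.le] at hgi ⊢
    exact hgi.congr (hae'.mono fun x hx => hx.symm)
  have e : ∫ x in y..T, (x - y) * g x = ∫ x in y..T, (x - y) * deriv p x := by
    rw [intervalIntegral.integral_of_le hy.2.le, intervalIntegral.integral_of_le hy.2.le,
      integral_Ioc_eq_integral_Ioo, integral_Ioc_eq_integral_Ioo]
    exact integral_congr_ae (hae'.mono fun x hx => by simp only [hx])
  rw [e, intervalIntegral.integral_mul_deriv_eq_deriv_mul_of_hasDeriv_right
    (u := fun x => x - y) (u' := fun _ => 1) (v := p)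
    (by fun_prop) ?_ (fun x _ => ((hasDerivAt_id x).sub_const y).hasDerivWithinAt) ?_
    (continuous_const.intervalIntegrable _ _) hpi]
  · simp [hp]
  · rw [uIcc_of_le hy.2.le]
    exact (continuousOn_primitive_Icc hT hg).mono (Icc_subset_Icc_left hy.1)
  · rw [min_eq_left hy.2.le, max_eq_right hy.2.le]
    intro x hx
    exact (hd.differentiableAt (isOpen_Ioo.mem_nhds
      ⟨hy.1.trans_lt hx.1, hx.2⟩)).hasDerivAt.hasDerivWithinAt

/-- Cauchy–Schwarz against an indicator; it is the source of the endpoint decay needed for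
truncation. -/
theorem abs_integral_le_norm_mul_sqrt (g : L2 T) {a b : ℝ} (ha : 0 ≤ a) (hab : a ≤ b)
    (hb : b ≤ T) : |∫ t in a..b, g t| ≤ ‖g‖ * √(b - a) := by
  have hs : Ioo a b ⊆ Ioo 0 T := Ioo_subset_Ioo ha hb
  have hr : (volume.restrict (Ioo 0 T)).restrict (Ioo a b) = volume.restrict (Ioo a b) :=
    Measure.restrict_restrict_of_subset hs
  have hfin : (volume.restrict (Ioo 0 T)) (Ioo a b) ≠ ⊤ := measure_ne_top _ _
  have h := L2.inner_indicatorConstLp_one (𝕜 := ℝ) measurableSet_Ioo hfin g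
  rw [hr, ← integral_Ioc_eq_integral_Ioo, ← intervalIntegral.integral_of_le hab] at h
  have hv : (volume.restrict (Ioo 0 T)).real (Ioo a b) = b - a := by
    rw [measureReal_restrict_apply measurableSet_Ioo, inter_eq_self_of_subset_left hs,
      Real.volume_real_Ioo_of_le hab]
  rw [← h]
  refine (abs_real_inner_le_norm _ _).trans (le_of_eq ?_)
  rw [norm_indicatorConstLp two_ne_zero ENNReal.ofNat_ne_top, hv, Real.sqrt_eq_rpow]
  simp [mul_comm]

end Primitive

/-! ### Complementary slackness: `u` has zero second derivative off the contact set. -/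

theorem exists_lt_forall_le_of_isCompact {K : Set ℝ} (hK : IsCompact K) {h : ℝ → ℝ}
    (hh : ContinuousOn h K) {c : ℝ} (hc : ∀ x ∈ K, h x < c) : ∃ c' < c, ∀ x ∈ K, h x ≤ c' := by
  rcases K.eq_empty_or_nonempty with rfl | hne
  · exact ⟨c - 1, by linarith, by simp⟩
  · obtain ⟨x, hx, hmax⟩ := hK.exists_isMaxOn hne hh
    exact ⟨h x, hc x hx, fun y hy => hmax hy⟩

/-- Where the constraints on the dual variable are inactive, the second derivative of `u`
vanishes. -/
theorem integral_mul_deriv_deriv_nonpos (hT : 0 < T) (hβ : 0 < β) {u : L2 T}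
    (hu : u ∈ BV T) {g P : ℝ → ℝ} {G : ℝ}
    (hg : MemLp g 2 (volume.restrict (Ioo 0 T)))
    (hgu : (∫ x in Ioo 0 T, g x * u x) + TGV T α β u ≤ 0)
    (hP : ContDiffOn ℝ ∞ P (Ioo 0 T))
    (hP2 : ∀ᵐ x ∂volume.restrict (Ioo 0 T), deriv (deriv P) x = -g x)
    (hPα : ∀ x ∈ Ioo 0 T, |P x| ≤ α) (hPβ : ∀ x ∈ Ioo 0 T, |deriv P x| ≤ β)
    (hend : ∀ r, 0 < r → ∀ x ∈ Ioo 0 T, (x ≤ r ∨ T - r ≤ x) →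
      |deriv P x| ≤ G * √r ∧ |P x| ≤ G * (r * √r))
    {φ : ℝ → ℝ} (hφ : IsTestOn {x ∈ Ioo 0 T | |P x| < α ∧ |deriv P x| < β} φ) :
    ∫ x in Ioo 0 T, u x * deriv (deriv φ) x ≤ 0 := by
  have hφT : IsTestOn (Ioo 0 T) φ := hφ.mono fun x hx => hx.1
  have hK : IsCompact (tsupport φ) := hφ.2.1
  have hP1 : ContDiffOn ℝ ∞ (deriv P) (Ioo 0 T) :=
    ((contDiffOn_infty_iff_deriv_of_isOpen isOpen_Ioo).1 hP).2
  obtain ⟨α', hα', hKα⟩ := exists_lt_forall_le_of_isCompact hK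
    (hP.continuousOn.mono hφT.2.2).abs fun x hx => (hφ.2.2 hx).2.1
  obtain ⟨β', hβ', hKβ⟩ := exists_lt_forall_le_of_isCompact hK
    (hP1.continuousOn.mono hφT.2.2).abs fun x hx => (hφ.2.2 hx).2.2
  obtain ⟨c, d, hc, hcd, hd, hKcd⟩ := exists_Icc_of_isCompact_subset_Ioo hT hK hφT.2.2
  obtain ⟨C, hC, hφC⟩ := hφ.exists_bound
  obtain ⟨D, hD, hφD⟩ := hφ.deriv.exists_bound
  -- On the compact support of `φ` both constraints have uniform slack, and `ε` is small enough for
  -- `ε * φ` and its derivative to fit into it.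
  obtain ⟨ε, hε, hεC, hεD⟩ : ∃ ε : ℝ, 0 < ε ∧ ε * C ≤ α - α' ∧ ε * D ≤ β - β' := by
    have h1 : 0 < α - α' := sub_pos.2 hα'
    have h2 : 0 < β - β' := sub_pos.2 hβ'
    refine ⟨min ((α - α') / (C + 1)) ((β - β') / (D + 1)), by positivity, ?_, ?_⟩
    · calc _ ≤ (α - α') / (C + 1) * (C + 1) :=
            mul_le_mul (min_le_left _ _) (by linarith) hC (by positivity)
        _ = α - α' := by field_simp
    · calc _ ≤ (β - β') / (D + 1) * (D + 1) :=
            mul_le_mul (min_le_right _ _) (by linarith) hD (by positivity)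
        _ = β - β' := by field_simp
  suffices ε * ∫ x in Ioo 0 T, u x * deriv (deriv φ) x ≤ 0 from
    nonpos_of_mul_nonpos_right this hε
  refine le_of_forall_pos_le_add fun e he => ?_
  -- The truncation has to coincide with `P` on a neighbourhood of the support of `φ`, where the
  -- slack of `deriv P` is used.
  obtain ⟨r₀, hr₀, hr1, hr2⟩ : ∃ r₀ : ℝ, 0 < r₀ ∧ r₀ < c ∧ d < T - r₀ := by
    have := lt_min hc (sub_pos.2 hd)
    exact ⟨min c (T - d) / 2, by positivity, by linarith [min_le_left c (T - d)],
      by linarith [min_le_right c (T - d)]⟩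
  obtain ⟨v, hv, hvP, hvα, hvβ, hve⟩ := exists_test_approx hT hβ (Lp.memLp u) hg hP hP2 hPβ hend
    he hr₀
  have hw := hv.add (hφT.const_mul ε)
  have hdw : deriv (fun x => v x + ε * φ x) = fun x => deriv v x + ε * deriv φ x := funext fun x => by
    rw [deriv_fun_add (hv.differentiable x) ((hφT.const_mul ε).differentiable x),
      deriv_const_mul _ (hφT.differentiable x)]
  have hddw : deriv (fun x => deriv v x + ε * deriv φ x) =
      fun x => deriv (deriv v) x + ε * deriv (deriv φ) x := funext fun x => by
    rw [deriv_fun_add (hv.deriv.differentiable x) ((hφT.deriv.const_mul ε).differentiable x),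
      deriv_const_mul _ (hφT.deriv.differentiable x)]
  have hKr : tsupport φ ⊆ Ioo r₀ (T - r₀) := fun x hx =>
    ⟨hr1.trans_le (hKcd hx).1, (hKcd hx).2.trans_lt hr2⟩
  have hadm : Admissible T α β (fun x => v x + ε * φ x) := by
    refine ⟨hw, fun x hx => ?_, fun x hx => ?_⟩
    · by_cases hxK : x ∈ tsupport φ
      · have h1 : |ε * φ x| ≤ ε * C := by
          rw [abs_mul, abs_of_pos hε]
          exact mul_le_mul_of_nonneg_left (hφC x) hε.le
        have h2 := (hvα x hx).trans (hKα x hxK)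
        linarith [abs_add_le (v x) (ε * φ x)]
      · beta_reduce
        rw [image_eq_zero_of_notMem_tsupport hxK, mul_zero, add_zero]
        exact (hvα x hx).trans (hPα x hx)
    · rw [hdw]
      by_cases hxK : x ∈ tsupport φ
      · have h1 : |ε * deriv φ x| ≤ ε * D := by
          rw [abs_mul, abs_of_pos hε]
          exact mul_le_mul_of_nonneg_left (hφD x) hε.le
        have h2 : deriv v x = deriv P x :=
          (hvP.eventuallyEq_of_mem (isOpen_Ioo.mem_nhds (hKr hxK))).deriv_eq
        have h3 := hKβ x hxK
        simp only [h2]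
        linarith [abs_add_le (deriv P x) (ε * deriv φ x)]
      · have h0 : deriv φ x = 0 :=
          image_eq_zero_of_notMem_tsupport fun h => hxK (tsupport_deriv_subset h)
        simpa [h0] using hvβ x hx
  -- Admissibility gives $\operatorname{TGV}(u)\ge\int uv''+\varepsilon\int u\varphi''\ge-\int
  -- gu-e+\varepsilon\int u\varphi''\ge\operatorname{TGV}(u)-e+\varepsilon\int u\varphi''$.
  have hle := le_TGV hβ hu hadm
  rw [hdw, hddw] at hle
  have hsplit : ∫ x in Ioo 0 T, u x * (deriv (deriv v) x + ε * deriv (deriv φ) x) =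
      (∫ x in Ioo 0 T, u x * deriv (deriv v) x) +
        ε * ∫ x in Ioo 0 T, u x * deriv (deriv φ) x := by
    rw [← integral_const_mul, ← integral_add (hv.deriv.deriv.integrable_mul (integrableOn_coe u))
      ((hφT.deriv.deriv.integrable_mul (integrableOn_coe u)).const_mul ε)]
    exact integral_congr_ae (Eventually.of_forall fun x => by simp only; ring)
  rw [hsplit] at hle
  linarith [(abs_le.1 hve).1]

theorem integral_mul_deriv_deriv_eq_zero (hT : 0 < T) (hβ : 0 < β) {u : L2 T}
    (hu : u ∈ BV T) {g P : ℝ → ℝ} {G : ℝ}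
    (hg : MemLp g 2 (volume.restrict (Ioo 0 T)))
    (hgu : (∫ x in Ioo 0 T, g x * u x) + TGV T α β u ≤ 0)
    (hP : ContDiffOn ℝ ∞ P (Ioo 0 T))
    (hP2 : ∀ᵐ x ∂volume.restrict (Ioo 0 T), deriv (deriv P) x = -g x)
    (hPα : ∀ x ∈ Ioo 0 T, |P x| ≤ α) (hPβ : ∀ x ∈ Ioo 0 T, |deriv P x| ≤ β)
    (hend : ∀ r, 0 < r → ∀ x ∈ Ioo 0 T, (x ≤ r ∨ T - r ≤ x) →
      |deriv P x| ≤ G * √r ∧ |P x| ≤ G * (r * √r))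
    {φ : ℝ → ℝ} (hφ : IsTestOn {x ∈ Ioo 0 T | |P x| < α ∧ |deriv P x| < β} φ) :
    ∫ x in Ioo 0 T, u x * deriv (deriv φ) x = 0 := by
  have key := fun {ψ : ℝ → ℝ} => integral_mul_deriv_deriv_nonpos (φ := ψ) hT hβ hu hg hgu hP hP2
    hPα hPβ hend
  refine le_antisymm (key hφ) ?_
  have h := key (hφ.const_mul (-1))
  have e : deriv (deriv fun x => -1 * φ x) = fun x => -deriv (deriv φ) x := by
    simp only [neg_one_mul, deriv.fun_neg']
  simp only [e, mul_neg] at h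
  rw [integral_neg] at h
  linarith

/-! ### Bounds and boundary values of the dual variables. -/

section DualVariables

variable {f : L2 T → ℝ} {u : L2 T}

@[simp]
theorem dualp_zero : dualp f u 0 = 0 := by simp [dualp]

@[simp]
theorem dualP_zero : dualP f u 0 = 0 := by simp [dualP]

theorem continuousOn_dualp (hT : 0 ≤ T) : ContinuousOn (dualp f u) (Icc 0 T) :=
  continuousOn_primitive_Icc hT (integrableOn_coe _)

theorem integrableOn_dualp (hT : 0 ≤ T) : IntegrableOn (dualp f u) (Ioo 0 T) :=
  ((continuousOn_dualp hT).integrableOn_compact isCompact_Icc).mono_set Ioo_subset_Icc_self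

theorem continuousOn_dualP (hT : 0 ≤ T) : ContinuousOn (dualP f u) (Icc 0 T) :=
  (continuousOn_primitive_Icc hT (integrableOn_dualp hT)).neg

theorem deriv_dualP {x : ℝ} (hx : x ∈ Ioo 0 T) : deriv (dualP f u) x = -dualp f u x := by
  have hT : 0 ≤ T := (hx.1.trans hx.2).le
  have hc : ContinuousOn (dualp f u) (Ioo 0 T) :=
    (continuousOn_dualp hT).mono Ioo_subset_Icc_self
  exact (intervalIntegral.integral_hasDerivAt_right
    (intervalIntegrable_of_integrableOn (integrableOn_dualp hT) le_rfl hx.1.le hx.2.le)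
    (hc.stronglyMeasurableAtFilter isOpen_Ioo x hx)
    (hc.continuousAt (isOpen_Ioo.mem_nhds hx))).neg.deriv

theorem ae_deriv_deriv_dualP (hT : 0 ≤ T) :
    ∀ᵐ x ∂volume.restrict (Ioo 0 T), deriv (deriv (dualP f u)) x = -(gradient f u : L2 T) x := by
  filter_upwards [ae_deriv_primitive_eq hT (integrableOn_coe (gradient f u)),
    ae_restrict_mem measurableSet_Ioo] with x hx hxm
  have h : deriv (dualP f u) =ᶠ[𝓝 x] fun x => -dualp f u x :=
    eventually_of_mem (isOpen_Ioo.mem_nhds hxm) fun y hy => deriv_dualP hy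
  rw [h.deriv_eq, deriv.fun_neg]
  exact congrArg _ hx

theorem integral_jump_mul_gradient {y : ℝ} (hy : y ∈ Ico 0 T) :
    ∫ x in Ioo 0 T, jump T y x * (gradient f u : L2 T) x = dualp f u T - dualp f u y := by
  rw [jump, setIntegral_indicator_mul hy]
  simp only [one_mul]
  exact primitive_sub_primitive (integrableOn_coe _) ⟨hy.1, hy.2.le⟩

theorem integral_ramp_mul_gradient (hp : DifferentiableOn ℝ (dualp f u) (Ioo 0 T)) {y : ℝ}
    (hy : y ∈ Ico 0 T) : ∫ x in Ioo 0 T, ramp T y x * (gradient f u : L2 T) x =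
      (T - y) * dualp f u T + (dualP f u T - dualP f u y) := by
  rw [ramp, setIntegral_indicator_mul hy, integral_ramp_mul (integrableOn_coe _) hp hy]
  have h := primitive_sub_primitive (integrableOn_dualp (f := f) (u := u) (hy.1.trans hy.2.le))
    (x := y) ⟨hy.1, hy.2.le⟩
  change (T - y) * dualp f u T - ∫ x in y..T, dualp f u x = _
  rw [h, dualP, dualP]
  ring

theorem abs_dualp_sub_le (hα : 0 < α) (hβ : 0 < β) (hf : Differentiable ℝ f) (hu : u ∈ BV T)
    (hmin : IsMinOn (fun v : L2 T => f v + TGV T α β v) (BV T) u) {y M : ℝ} (hy : y ∈ Ico 0 T)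
    (hM : ∀ v, Admissible T α β v → |deriv v y| ≤ M) : |dualp f u T - dualp f u y| ≤ M := by
  rw [← integral_jump_mul_gradient hy]
  refine abs_integral_gradient_mul_le hα hβ hf hu hmin (memLp_jump T y) (isBV_jump hy)
    fun v hv => ?_
  rw [jump, setIntegral_indicator_mul hy, hv.1.deriv.integral_jump, abs_neg]
  exact hM v hv

theorem abs_dualP_sub_le (hα : 0 < α) (hβ : 0 < β) (hf : Differentiable ℝ f) (hu : u ∈ BV T)
    (hmin : IsMinOn (fun v : L2 T => f v + TGV T α β v) (BV T) u)
    (hp : DifferentiableOn ℝ (dualp f u) (Ioo 0 T)) {y M : ℝ} (hy : y ∈ Ico 0 T)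
    (hM : ∀ v, Admissible T α β v → |v y| ≤ M) :
    |(T - y) * dualp f u T + (dualP f u T - dualP f u y)| ≤ M := by
  rw [← integral_ramp_mul_gradient hp hy]
  refine abs_integral_gradient_mul_le hα hβ hf hu hmin (memLp_ramp hy) (isBV_ramp hy)
    fun v hv => ?_
  have h : ∫ x in y..T, deriv v x = -v y := by simpa using hv.1.integral_jump y
  rw [ramp, setIntegral_indicator_mul hy, hv.1.deriv.integral_ramp, h, neg_neg]
  exact hM v hv

/-- On `(0,T)` the jump at `0` is the constant `1`, which TGV does not see, so the gradient has mean
zero. Likewise the ramp at `0` is the identity, which yields `dualP_right`. -/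
theorem dualp_right (hT : 0 < T) (hα : 0 < α) (hβ : 0 < β) (hf : Differentiable ℝ f)
    (hu : u ∈ BV T) (hmin : IsMinOn (fun v : L2 T => f v + TGV T α β v) (BV T) u) :
    dualp f u T = 0 := by
  have h := abs_dualp_sub_le hα hβ hf hu hmin (y := 0) (M := 0) ⟨le_rfl, hT⟩
    fun v hv => by rw [hv.1.deriv.eq_zero (by simp), abs_zero]
  simpa using h

theorem dualP_right (hT : 0 < T) (hα : 0 < α) (hβ : 0 < β) (hf : Differentiable ℝ f)
    (hu : u ∈ BV T) (hmin : IsMinOn (fun v : L2 T => f v + TGV T α β v) (BV T) u)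
    (hp : DifferentiableOn ℝ (dualp f u) (Ioo 0 T)) : dualP f u T = 0 := by
  have h := abs_dualP_sub_le hα hβ hf hu hmin hp (y := 0) (M := 0) ⟨le_rfl, hT⟩
    fun v hv => by rw [hv.1.eq_zero (by simp), abs_zero]
  simpa [dualp_right hT hα hβ hf hu hmin] using h

theorem abs_dualp_le_norm_mul_sqrt (hT : dualp f u T = 0) {r : ℝ} {x : ℝ}
    (hx : x ∈ Icc 0 T) (hxr : x ≤ r ∨ T - r ≤ x) : |dualp f u x| ≤ ‖gradient f u‖ * √r := by
  rcases hxr with h | h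
  · calc |dualp f u x| ≤ ‖gradient f u‖ * √(x - 0) :=
          abs_integral_le_norm_mul_sqrt _ le_rfl hx.1 hx.2
      _ ≤ ‖gradient f u‖ * √r := by gcongr; linarith
  · have e := primitive_sub_primitive (integrableOn_coe (gradient f u)) hx
    have e' : dualp f u x = -∫ t in x..T, (gradient f u : L2 T) t := by
      rw [e]
      change _ = -(dualp f u T - dualp f u x)
      rw [hT]
      ring
    rw [e', abs_neg]
    calc _ ≤ ‖gradient f u‖ * √(T - x) := abs_integral_le_norm_mul_sqrt _ hx.1 hx.2 le_rfl
      _ ≤ ‖gradient f u‖ * √r := by gcongr; linarith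

/-- Integrating the bound on `dualp` from the nearby endpoint, where `dualP` vanishes, gains one
more power of `r`. -/
theorem abs_dualP_le_norm_mul_sqrt (hT : dualp f u T = 0) (hT' : dualP f u T = 0) {r : ℝ} {x : ℝ}
    (hx : x ∈ Icc 0 T) (hxr : x ≤ r ∨ T - r ≤ x) :
    |dualP f u x| ≤ ‖gradient f u‖ * (r * √r) := by
  have hT0 : 0 ≤ T := hx.1.trans hx.2
  have key : ∀ a b, 0 ≤ a → a ≤ b → b ≤ T → b - a ≤ r → (b ≤ r ∨ T - r ≤ a) →
      |∫ t in a..b, dualp f u t| ≤ ‖gradient f u‖ * (r * √r) := by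
    intro a b ha hab hb hr hor
    have h := intervalIntegral.norm_integral_le_of_norm_le_const (a := a) (b := b)
      (f := dualp f u) (C := ‖gradient f u‖ * √r) fun t ht => by
        rw [uIoc_of_le hab] at ht
        exact abs_dualp_le_norm_mul_sqrt hT ⟨ha.trans ht.1.le, ht.2.trans hb⟩
          (hor.imp ht.2.trans fun h' => h'.trans ht.1.le)
    rw [Real.norm_eq_abs, abs_of_nonneg (sub_nonneg.2 hab)] at h
    calc _ ≤ ‖gradient f u‖ * √r * (b - a) := h
      _ ≤ ‖gradient f u‖ * √r * r := by gcongr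
      _ = _ := by ring
  rcases hxr with h | h
  · rw [dualP, abs_neg]
    exact key 0 x le_rfl hx.1 hx.2 (by linarith) (Or.inl h)
  · have e := primitive_sub_primitive (integrableOn_dualp (f := f) (u := u) hT0) hx
    have e' : dualP f u x = ∫ t in x..T, dualp f u t := by
      rw [e]
      simp only [dualP] at hT' ⊢
      linarith
    rw [e']
    exact key x T hx.1 hx.2 le_rfl (by linarith) (Or.inr h)

end DualVariables

end TGVReg

/-! ### Conclusion. -/

open TGVReg in
theorem corollary4 (T α β : ℝ) (hT : 0 < T) (hα : 0 < α) (hβ : 0 < β)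
    (f : TGVReg.L2 T → ℝ) (hf : Differentiable ℝ f)
    (u : TGVReg.L2 T) (hu : u ∈ TGVReg.BV T)
    (hmin : IsMinOn (fun v : TGVReg.L2 T => f v + TGVReg.TGV T α β v) (TGVReg.BV T) u)
    (hp : AnalyticOnNhd ℝ (TGVReg.dualp f u) (Set.Ioo 0 T))
    (hP : AnalyticOnNhd ℝ (TGVReg.dualP f u) (Set.Ioo 0 T)) :
    TGVReg.IsSparse T α β u := by
  have hpd : DifferentiableOn ℝ (dualp f u) (Ioo 0 T) := hp.differentiableOn
  have hpT := dualp_right hT hα hβ hf hu hmin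
  have hPT := dualP_right hT hα hβ hf hu hmin hpd
  have hpβ : ∀ x ∈ Ioo 0 T, |dualp f u x| ≤ β := fun x hx => by
    simpa [hpT] using abs_dualp_sub_le hα hβ hf hu hmin (Ioo_subset_Ico_self hx)
      fun v hv => hv.2.2 x hx
  have hPα : ∀ x ∈ Ioo 0 T, |dualP f u x| ≤ α := fun x hx => by
    simpa [hpT, hPT] using abs_dualP_sub_le hα hβ hf hu hmin hpd (Ioo_subset_Ico_self hx)
      fun v hv => hv.2.1 x hx
  have hgu := inner_gradient_add_TGV_le hα hβ hf hu hmin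
  rw [inner_eq_integral] at hgu
  have hpfin : ∀ c : ℝ, c ≠ 0 → {x ∈ Ioo 0 T | dualp f u x = c}.Finite := fun c hc =>
    finite_level_set hT hc hp (continuousOn_dualp hT.le) dualp_zero hpT
  have hPfin : ∀ c : ℝ, c ≠ 0 → {x ∈ Ioo 0 T | dualP f u x = c}.Finite := fun c hc =>
    finite_level_set hT hc hP (continuousOn_dualP hT.le) dualP_zero hPT
  have hfin := ((hpfin β hβ.ne').union (hpfin (-β) (neg_ne_zero.2 hβ.ne'))).union
    ((hPfin α hα.ne').union (hPfin (-α) (neg_ne_zero.2 hα.ne')))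
  refine isSparse_of_ae_affine hT hα hβ hfin.toFinset (fun e he => ?_)
    fun a b ha hab hb hE => ?_
  · rw [hfin.mem_toFinset] at he
    rcases he with (h | h) | (h | h) <;> exact h.1
  · have hsub : Ioo a b ⊆ Ioo 0 T := Ioo_subset_Ioo ha hb
    refine ae_eq_affine hab ((integrableOn_coe u).mono_set hsub) fun φ hφ => ?_
    -- An interval free of contact points leaves both constraints strict, so every test function on
    -- it is an allowed perturbation.
    have hφ' : IsTestOn {x ∈ Ioo 0 T | |dualP f u x| < α ∧ |deriv (dualP f u) x| < β} φ := by
      refine hφ.mono fun x hx => ?_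
      have hxT := hsub hx
      have hxE : x ∉ _ := fun h => hE x (hfin.mem_toFinset.2 h) hx
      refine ⟨hxT, lt_of_le_of_ne (hPα x hxT) fun h => hxE ?_, ?_⟩
      · exact Or.inr (((abs_eq hα.le).1 h).imp (fun h => ⟨hxT, h⟩) fun h => ⟨hxT, h⟩)
      · rw [deriv_dualP hxT, abs_neg]
        refine lt_of_le_of_ne (hpβ x hxT) fun h => hxE ?_
        exact Or.inl (((abs_eq hβ.le).1 h).imp (fun h => ⟨hxT, h⟩) fun h => ⟨hxT, h⟩)
    have h0 := integral_mul_deriv_deriv_eq_zero hT hβ hu (Lp.memLp (gradient f u)) hgu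
      hP.contDiffOn_of_completeSpace (ae_deriv_deriv_dualP hT.le) hPα
      (fun x hx => by rw [deriv_dualP hx, abs_neg]; exact hpβ x hx)
      (fun r _ x hx hxr => ⟨by
        rw [deriv_dualP hx, abs_neg]
        exact abs_dualp_le_norm_mul_sqrt hpT (Ioo_subset_Icc_self hx) hxr,
        abs_dualP_le_norm_mul_sqrt hpT hPT (Ioo_subset_Icc_self hx) hxr⟩) hφ'
    rw [hφ.deriv.deriv.setIntegral_eq]
    rwa [(hφ.mono hsub).deriv.deriv.setIntegral_eq] at h0
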